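/- Let $n,m\ge 1$ be integers and $\alpha>0$. A smooth function $f\colon\mathbb{C}^n\to\mathbb{C}$ is called $m$-analytic if $\overline{D}^k f=0$ for every multi-index $k\in\mathbb{N}_0^n$ with $|k|=k_1+\dots+k_n=m$, where $\overline{D}^k=\prod_{r=1}^n(\partial/\partial\overline{z}_r)^{k_r}$. Let $\mathcal{F}_{\alpha,m}$ be the space of all $m$-analytic functions on $\mathbb{C}^n$ that are square integrable with respect to $\frac{\alpha^n}{\pi^n}e^{-\alpha|z|^2}\,dz$ ($dz$ is Lebesgue measure on $\mathbb{C}^n$). For $f\in\mathcal{F}_{\alpha,m}$ and $x,y\in\mathbb{R}^n$ put $$(Uf)(x,y)=2^{n/2}\,e^{-\frac12|x|^2-\frac12|y|^2-\mathrm{i}\langle x,y\rangle}\,f\!\left(\frac{x+\mathrm{i}y}{\sqrt{\alpha}}\right),$$ and let $\mathcal{H}_m=\{Uf\colon f\in\mathcal{F}_{\alpha,m}\}$ with the inner product and norm of $L^2(\mathbb{R}^{2n},(2\pi)^{-n}\,dx\,dy)$. Then $\mathcal{H}_m$ is a reproducing kernel Hilbert space of functions on $\mathbb{R}^{2n}$,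 i.e. it is complete and every point evaluation is a bounded functional. Its reproducing kernel is $$K_{x,y}(u,v)=2^n\,e^{-\frac12(|u-x|^2+|v-y|^2)-\mathrm{i}\langle u-x,\,v+y\rangle}\,L_{m-1}^{(n)}\bigl(|u-x|^2+|v-y|^2\bigr)\qquad(x,y,u,v\in\mathbb{R}^n),$$ where $L_p^{(n)}(t)=\sum_{i=0}^p(-1)^i\binom{p+n}{p-i}\frac{t^i}{i!}$ is the generalized Laguerre polynomial. For all $x,y\in\mathbb{R}^n$ the norm of the kernel is $$\|K_{x,y}\|_{\mathcal{H}_m}=\sqrt{2^n d_{n,m}},\qquad d_{n,m}=\#\{k\in\mathbb{N}_0^n\colon|k|\le m-1\}=\binom{n+m-1}{n}.$$ In particular, the kernel is invariant under horizontal translations: $K_{x+a,y}(u+a,v)=K_{x,y}(u,v)$ for all $a,x,y,u,v\in\mathbb{R}^n$. -/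

import Mathlib

open MeasureTheory
open scoped ContDiff

noncomputable section

namespace PolyFock

/-- The Wirtinger operator `∂/∂z̄_r = (∂/∂x_r + i ∂/∂y_r) / 2` on functions `ℂⁿ → ℂ`. -/
def dbar {n : ℕ} (r : Fin n) (f : (Fin n → ℂ) → ℂ) : (Fin n → ℂ) → ℂ := fun z =>
  (1 / 2 : ℂ) * (fderiv ℝ f z (Pi.single r 1) + Complex.I * fderiv ℝ f z (Pi.single r Complex.I))

/-- The operator `D̄ᵏ = ∏_r (∂/∂z̄_r)^{k_r}` for a multi-index `k`. -/
def dbarPow {n : ℕ} (k : Fin n → ℕ) (f : (Fin n → ℂ) → ℂ) : (Fin n → ℂ) → ℂ :=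
  (List.finRange n).foldr (fun r g => (dbar r)^[k r] g) f

/-- (Homogeneously) `m`-analytic functions: smooth functions with `D̄ᵏ f = 0` for all `|k| = m`. -/
def IsPolyanalytic {n : ℕ} (m : ℕ) (f : (Fin n → ℂ) → ℂ) : Prop :=
  ContDiff ℝ ∞ f ∧ ∀ k : Fin n → ℕ, ∑ r, k r = m → dbarPow k f = 0

lemma contDiff_dbar {n : ℕ} (r : Fin n) {f : (Fin n → ℂ) → ℂ} (hf : ContDiff ℝ ∞ f) :
    ContDiff ℝ ∞ (dbar r f) := by
  have h : ContDiff ℝ ∞ (fderiv ℝ f) := hf.fderiv_right (m := ∞) (by simp)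
  unfold dbar
  fun_prop

lemma dbar_add {n : ℕ} (r : Fin n) {f g : (Fin n → ℂ) → ℂ} (hf : ContDiff ℝ ∞ f)
    (hg : ContDiff ℝ ∞ g) : dbar r (f + g) = dbar r f + dbar r g := by
  funext z
  have h1 := (hf.differentiable (by simp)) z
  have h2 := (hg.differentiable (by simp)) z
  simp only [dbar, fderiv_add h1 h2, Pi.add_apply, add_apply]
  ring

lemma dbar_smul {n : ℕ} (r : Fin n) (c : ℂ) {f : (Fin n → ℂ) → ℂ} (hf : ContDiff ℝ ∞ f) :
    dbar r (c • f) = c • dbar r f := by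
  funext z
  have h1 := (hf.differentiable (by simp)) z
  simp only [dbar, fderiv_const_smul h1 c, Pi.smul_apply, smul_apply, smul_eq_mul]
  ring

lemma iter_dbar {n : ℕ} (r : Fin n) (j : ℕ) :
    (∀ f : (Fin n → ℂ) → ℂ, ContDiff ℝ ∞ f → ContDiff ℝ ∞ ((dbar r)^[j] f)) ∧
    (∀ f g : (Fin n → ℂ) → ℂ, ContDiff ℝ ∞ f → ContDiff ℝ ∞ g →
      (dbar r)^[j] (f + g) = (dbar r)^[j] f + (dbar r)^[j] g) ∧
    (∀ (c : ℂ) (f : (Fin n → ℂ) → ℂ), ContDiff ℝ ∞ f →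
      (dbar r)^[j] (c • f) = c • (dbar r)^[j] f) := by
  induction j with
  | zero => simp
  | succ j ih =>
    obtain ⟨h1, h2, h3⟩ := ih
    simp only [Function.iterate_succ', Function.comp_apply]
    refine ⟨fun f hf => contDiff_dbar r (h1 f hf), fun f g hf hg => ?_, fun c f hf => ?_⟩
    · rw [h2 f g hf hg, dbar_add r (h1 f hf) (h1 g hg)]
    · rw [h3 c f hf, dbar_smul r c (h1 f hf)]

lemma foldr_dbar {n : ℕ} (k : Fin n → ℕ) (l : List (Fin n)) :
    (∀ f : (Fin n → ℂ) → ℂ, ContDiff ℝ ∞ f →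
      ContDiff ℝ ∞ (l.foldr (fun r g => (dbar r)^[k r] g) f)) ∧
    (∀ f g : (Fin n → ℂ) → ℂ, ContDiff ℝ ∞ f → ContDiff ℝ ∞ g →
      l.foldr (fun r g => (dbar r)^[k r] g) (f + g) =
        l.foldr (fun r g => (dbar r)^[k r] g) f + l.foldr (fun r g => (dbar r)^[k r] g) g) ∧
    (∀ (c : ℂ) (f : (Fin n → ℂ) → ℂ), ContDiff ℝ ∞ f →
      l.foldr (fun r g => (dbar r)^[k r] g) (c • f) =
        c • l.foldr (fun r g => (dbar r)^[k r] g) f) := by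
  induction l with
  | nil => simp
  | cons a l ih =>
    obtain ⟨h1, h2, h3⟩ := ih
    obtain ⟨i1, i2, i3⟩ := iter_dbar a (k a)
    simp only [List.foldr_cons]
    refine ⟨fun f hf => i1 _ (h1 f hf), fun f g hf hg => ?_, fun c f hf => ?_⟩
    · rw [h2 f g hf hg, i2 _ _ (h1 f hf) (h1 g hg)]
    · rw [h3 c f hf, i3 _ _ (h1 f hf)]

/-- The measure `(α/π)ⁿ exp(-α |z|²) dz` on `ℂⁿ`, with the Euclidean `|z|² = ∑ |z_r|²`. -/
def gaussMeasure (n : ℕ) (α : ℝ) : Measure (Fin n → ℂ) :=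
  volume.withDensity fun z =>
    ENNReal.ofReal ((α / Real.pi) ^ n * Real.exp (-α * ∑ r, ‖z r‖ ^ 2))

/-- The `m`-analytic Bargmann--Segal--Fock space of functions on `ℂⁿ`. -/
def fock (n m : ℕ) (α : ℝ) : Submodule ℂ ((Fin n → ℂ) → ℂ) where
  carrier := {f | IsPolyanalytic m f ∧ MemLp f 2 (gaussMeasure n α)}
  add_mem' := by
    rintro f g ⟨⟨hf, hf'⟩, hf2⟩ ⟨⟨hg, hg'⟩, hg2⟩
    refine ⟨⟨hf.add hg, fun k hk => ?_⟩, hf2.add hg2⟩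
    have h := (foldr_dbar k (List.finRange n)).2.1 f g hf hg
    have h1 := hf' k hk
    have h2 := hg' k hk
    unfold dbarPow at *
    rw [h, h1, h2, add_zero]
  zero_mem' := by
    refine ⟨⟨contDiff_const, fun k hk => ?_⟩, MemLp.zero⟩
    have h := (foldr_dbar k (List.finRange n)).2.2 0 0 contDiff_const
    simpa [dbarPow] using h
  smul_mem' := by
    rintro c f ⟨⟨hf, hf'⟩, hf2⟩
    refine ⟨⟨contDiff_const.smul hf, fun k hk => ?_⟩, hf2.const_smul c⟩
    have h := (foldr_dbar k (List.finRange n)).2.2 c f hf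
    have h1 := hf' k hk
    unfold dbarPow at *
    rw [h, h1, smul_zero]

/-- `ℝ²ⁿ`, written as pairs `(x, y)` of vectors of the Euclidean space `ℝⁿ`. -/
abbrev R2 (n : ℕ) : Type := EuclideanSpace ℝ (Fin n) × EuclideanSpace ℝ (Fin n)

/-- The point `(x + i y) / √α` of `ℂⁿ`. -/
def toCn (n : ℕ) (α : ℝ) (p : R2 n) : Fin n → ℂ := fun r =>
  ((p.1 r : ℂ) + Complex.I * (p.2 r : ℂ)) / (Real.sqrt α : ℂ)

/-- The flattening operator
`(U f)(x, y) = 2^{n/2} exp(-|x|²/2 - |y|²/2 - i⟨x, y⟩) f((x + i y)/√α)`. -/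
def flatten (n : ℕ) (α : ℝ) : ((Fin n → ℂ) → ℂ) →ₗ[ℂ] (R2 n → ℂ) where
  toFun f := fun p =>
    (((2 : ℝ) ^ ((n : ℝ) / 2) : ℝ) : ℂ) *
      Complex.exp (-(1 / 2) * (‖p.1‖ ^ 2 : ℝ) - (1 / 2) * (‖p.2‖ ^ 2 : ℝ)
        - Complex.I * (inner ℝ p.1 p.2 : ℝ)) *
      f (toCn n α p)
  map_add' f g := by
    funext p
    simp only [Pi.add_apply]
    ring
  map_smul' c f := by
    funext p
    simp only [Pi.smul_apply, smul_eq_mul, RingHom.id_apply]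
    ring

/-- The measure `(2π)^{-n} dx dy` on `ℝ²ⁿ`. -/
def flatMeasure (n : ℕ) : Measure (R2 n) :=
  ENNReal.ofReal (((2 * Real.pi) ^ n)⁻¹) • volume

/-- The underlying set of functions of the flattened space: the image of the Fock space under
the flattening operator. -/
def flatSubmodule (n m : ℕ) (α : ℝ) : Submodule ℂ (R2 n → ℂ) :=
  (fock n m α).map (flatten n α)

lemma continuous_of_mem {n m : ℕ} {α : ℝ} {g : R2 n → ℂ} (hg : g ∈ flatSubmodule n m α) :
    Continuous g := by
  obtain ⟨f, ⟨⟨hf, -⟩, -⟩, rfl⟩ := hg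
  have h1 : Continuous (toCn n α) := by
    unfold toCn
    fun_prop
  have h2 : Continuous fun p => f (toCn n α p) := hf.continuous.comp h1
  change Continuous fun p => _ * _ * f (toCn n α p)
  fun_prop

/-- `(x, y) ↦ x + i y` preserves Lebesgue measure. -/
lemma measurePreserving_toCn_one (n : ℕ) :
    MeasurePreserving (toCn n 1) (volume : Measure (R2 n)) volume := by
  have h1 : MeasurePreserving (Prod.map (WithLp.ofLp (p := 2) (V := Fin n → ℝ))
      (WithLp.ofLp (p := 2) (V := Fin n → ℝ))) (volume : Measure (R2 n)) volume :=
    (PiLp.volume_preserving_ofLp (Fin n)).prod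
      (PiLp.volume_preserving_ofLp (Fin n))
  have h2 := (volume_measurePreserving_arrowProdEquivProdArrow ℝ ℝ (Fin n)).symm
  have h3 : MeasurePreserving (fun (a : Fin n → ℝ × ℝ) r =>
      Complex.measurableEquivRealProd.symm (a r)) volume volume :=
    volume_preserving_pi fun _ => Complex.volume_preserving_equiv_real_prod.symm
  have h := h3.comp (h2.comp h1)
  convert h using 1
  funext p r
  apply Complex.ext <;>
    simp [toCn, MeasurableEquiv.arrowProdEquivProdArrow, Equiv.arrowProdEquivProdArrow,
      Complex.measurableEquivRealProd]

lemma memLp_of_mem {n m : ℕ} {α : ℝ} (hα : 0 < α) {g : R2 n → ℂ}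
    (hg : g ∈ flatSubmodule n m α) : MemLp g 2 (flatMeasure n) := by
  have hc := continuous_of_mem hg
  rw [memLp_two_iff_integrable_sq_norm hc.aestronglyMeasurable]
  obtain ⟨f, ⟨⟨hf, -⟩, hf2⟩, rfl⟩ := hg
  rw [memLp_two_iff_integrable_sq_norm hf.continuous.aestronglyMeasurable] at hf2
  refine Integrable.smul_measure ?_ ENNReal.ofReal_ne_top
  have hpi := Real.pi_pos
  unfold gaussMeasure at hf2
  rw [integrable_withDensity_iff (by fun_prop) (by simp)] at hf2
  have h1 := hf2.comp_smul (R := (Real.sqrt α)⁻¹) (by positivity)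
  have h2 := ((measurePreserving_toCn_one n).integrable_comp h1.aestronglyMeasurable).2 h1
  refine (h2.const_mul (2 ^ n * ((α / Real.pi) ^ n)⁻¹)).congr (ae_of_all _ fun p => ?_)
  have e : (Real.sqrt α)⁻¹ • toCn n 1 p = toCn n α p := by
    funext r
    simp [toCn]
    ring
  have e2 : α * ∑ r, ‖toCn n α p r‖ ^ 2 = ‖p.1‖ ^ 2 + ‖p.2‖ ^ 2 := by
    rw [EuclideanSpace.real_norm_sq_eq, EuclideanSpace.real_norm_sq_eq, ← Finset.sum_add_distrib,
      Finset.mul_sum]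
    refine Finset.sum_congr rfl fun r _ => ?_
    simp only [toCn, norm_div, div_pow, Complex.norm_real, Real.norm_eq_abs, sq_abs,
      Real.sq_sqrt hα.le, mul_comm Complex.I]
    rw [← Complex.normSq_eq_norm_sq, Complex.normSq_add_mul_I]
    field_simp
  have e3 : ((2 : ℝ) ^ ((n : ℝ) / 2)) ^ 2 = 2 ^ n := by
    rw [← Real.rpow_natCast, ← Real.rpow_mul (by norm_num)]
    norm_num
  simp only [Function.comp_apply, e, flatten, LinearMap.coe_mk, AddHom.coe_mk, norm_mul,
    Complex.norm_exp, mul_pow, Complex.norm_real, Real.norm_eq_abs, sq_abs, e3, neg_mul, e2]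
  rw [ENNReal.toReal_ofReal (by positivity), ← Real.exp_nat_mul]
  have e4 : ((2 : ℕ) : ℝ) * (-((1 / 2 : ℂ) * ((‖p.1‖ ^ 2 : ℝ) : ℂ)) -
      1 / 2 * ((‖p.2‖ ^ 2 : ℝ) : ℂ) - Complex.I * ((inner ℝ p.1 p.2 : ℝ) : ℂ)).re
      = -(‖p.1‖ ^ 2 + ‖p.2‖ ^ 2) := by
    simp only [Complex.sub_re, Complex.neg_re, Complex.mul_re, Complex.ofReal_re,
      Complex.ofReal_im, Complex.I_re, Complex.I_im]
    norm_num
    ring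
  rw [e4]
  have : (α / Real.pi) ^ n ≠ 0 := by positivity
  field_simp

/-- The flattened space: the functions in the image of the flattening operator. It is a type of
its own because it carries the `L²` norm below, not the topology of pointwise convergence. -/
def FlatSpace (n m : ℕ) (α : ℝ) (_hα : 0 < α) : Type := flatSubmodule n m α

namespace FlatSpace

variable {n m : ℕ} {α : ℝ} {hα : 0 < α}

instance : AddCommGroup (FlatSpace n m α hα) :=
  inferInstanceAs (AddCommGroup (flatSubmodule n m α))

instance : Module ℂ (FlatSpace n m α hα) :=
  inferInstanceAs (Module ℂ (flatSubmodule n m α))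

/-- An element of the flattened space as a function on `ℝ²ⁿ`. -/
def toFun (g : FlatSpace n m α hα) : R2 n → ℂ := g.1

/-- The inclusion of the flattened space into `L²(ℝ²ⁿ, (2π)^{-n} dx dy)`. -/
def toL2 : FlatSpace n m α hα →ₗ[ℂ] Lp ℂ 2 (flatMeasure n) where
  toFun g := (memLp_of_mem hα g.2).toLp g.1
  map_add' _ _ := rfl
  map_smul' _ _ := rfl

lemma toL2_injective :
    Function.Injective (toL2 : FlatSpace n m α hα →ₗ[ℂ] Lp ℂ 2 (flatMeasure n)) := by
  intro g h hgh
  have h1 : g.1 =ᵐ[flatMeasure n] h.1 := 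
    (MemLp.toLp_eq_toLp_iff (memLp_of_mem hα g.2) (memLp_of_mem hα h.2)).1 hgh
  have hpi := Real.pi_pos
  have h0 : ENNReal.ofReal (((2 * Real.pi) ^ n)⁻¹) ≠ 0 := by
    simp only [ne_eq, ENNReal.ofReal_eq_zero, not_le]
    positivity
  unfold flatMeasure at h1
  have h2 : g.1 =ᵐ[volume] h.1 := by
    rwa [Filter.EventuallyEq, Measure.ae_ennreal_smul_measure_eq h0] at h1
  exact Subtype.ext ((continuous_of_mem g.2).ae_eq_iff_eq volume (continuous_of_mem h.2) |>.1 h2)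

/-- The norm of `L²(ℝ²ⁿ, (2π)^{-n} dx dy)`. -/
instance : NormedAddCommGroup (FlatSpace n m α hα) :=
  NormedAddCommGroup.induced _ _ toL2 toL2_injective

/-- The inner product of `L²(ℝ²ⁿ, (2π)^{-n} dx dy)`. -/
instance : InnerProductSpace ℂ (FlatSpace n m α hα) where
  norm_smul_le c g := by
    change ‖toL2 (c • g)‖ ≤ ‖c‖ * ‖toL2 g‖
    rw [map_smul, norm_smul]
  inner g h := inner ℂ (toL2 g) (toL2 h)
  norm_sq_eq_re_inner g := norm_sq_eq_re_inner (𝕜 := ℂ) (toL2 g)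
  conj_inner_symm g h := inner_conj_symm (toL2 g) (toL2 h)
  add_left f g h := by
    rw [map_add, inner_add_left]
  smul_left g h c := by
    rw [map_smul, inner_smul_left]

end FlatSpace

/-- The generalized Laguerre polynomial
`L_p^{(a)}(t) = ∑_{i=0}^p (-1)^i binom(p + a, p - i) t^i / i!`, for `a = 0, 1, 2, …`. -/
def laguerre (a p : ℕ) (t : ℝ) : ℝ :=
  ∑ i ∈ Finset.range (p + 1),
    (-1) ^ i * ((p + a).choose (p - i) : ℝ) * t ^ i / (i.factorial : ℝ)

/-- The number of multi-indices `k ∈ ℕ₀ⁿ` with `|k| ≤ m - 1`. -/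
def dim (n m : ℕ) : ℕ := Nat.card {k : Fin n → ℕ // ∑ r, k r < m}

end PolyFock

end

/-!
Let `F` be polyanalytic of order `m` on a complex inner product space. The averages of `F` over the
circles `θ ↦ e^{iθ} w` are polynomials of degree below `m` in the squared radius with constant term
`F 0`: on each complex line through the origin, the Taylor expansion in `z̄` breaks off. Hence
`∫ F w χ(‖w‖²) = F 0 ∫ χ(‖w‖²)` for every radial weight `χ` whose moments `∫ ‖w‖^{2k} χ(‖w‖²)`
vanish for `0 < k < m`, and the orthogonality of the Laguerre polynomials says that
`χ(t) = L_{m-1}^{(n)}(t) e^{-t}` is such a weight. Translating to a point `z` and multiplying `F` by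
the holomorphic function `u ↦ e^{-⟨z, u⟩}`, which leaves the order unchanged, yields the reproducing
kernel of the Fock space.

A compactly supported smooth weight with the same vanishing moments shows that `F` equals its own
convolution with a fixed test function. Polyanalyticity therefore passes to locally uniform limits.
Norm convergence implies uniform convergence because the norms of the kernels are bounded, so the
space is complete.
-/

noncomputable section

namespace PolyFock

section Wirtinger

variable {E E' : Type*} [NormedAddCommGroup E] [NormedSpace ℂ E] [NormedAddCommGroup E']
  [NormedSpace ℂ E'] {f g : E → ℂ}

/-- The Wirtinger derivative of `f : E → ℂ` in the direction `v` of a complex normed space: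
the conjugate-linear part of the real derivative, evaluated at `v`. On `ℂⁿ` with `v = e_r` it is
`∂f/∂z̄_r`. -/
def wirtinger (v : E) (f : E → ℂ) (z : E) : ℂ :=
  1 / 2 * (fderiv ℝ f z v + Complex.I * fderiv ℝ f z (Complex.I • v))

lemma dbar_eq_wirtinger {n : ℕ} (r : Fin n) : dbar r = wirtinger (Pi.single r 1) := by
  have h : (Complex.I • Pi.single r 1 : Fin n → ℂ) = Pi.single r Complex.I := by
    rw [← Pi.single_smul, smul_eq_mul, mul_one]
  simp only [funext_iff, dbar, wirtinger, h, implies_true]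

lemma contDiff_wirtinger (v : E) (hf : ContDiff ℝ ∞ f) : ContDiff ℝ ∞ (wirtinger v f) := by
  have : ContDiff ℝ ∞ (fderiv ℝ f) := hf.fderiv_right (m := ∞) (by simp)
  unfold wirtinger
  fun_prop

lemma wirtinger_add (v : E) (hf : Differentiable ℝ f) (hg : Differentiable ℝ g) :
    wirtinger v (f + g) = wirtinger v f + wirtinger v g := by
  funext z
  simp only [wirtinger, fderiv_add (hf z) (hg z), Pi.add_apply, add_apply]
  ring

lemma wirtinger_sub (v : E) (hf : Differentiable ℝ f) (hg : Differentiable ℝ g) :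
    wirtinger v (f - g) = wirtinger v f - wirtinger v g := by
  funext z
  simp only [wirtinger, fderiv_sub (hf z) (hg z), Pi.sub_apply, sub_apply]
  ring

lemma wirtinger_sum {ι : Type*} (s : Finset ι) (v : E) {F : ι → E → ℂ}
    (hF : ∀ i ∈ s, Differentiable ℝ (F i)) :
    wirtinger v (∑ i ∈ s, F i) = ∑ i ∈ s, wirtinger v (F i) := by
  funext z
  simp only [wirtinger, fderiv_sum fun i hi => hF i hi z, sum_apply, Finset.sum_apply,
    Finset.mul_sum, ← Finset.sum_add_distrib]

lemma wirtinger_mul (v : E) (hf : Differentiable ℝ f) (hg : Differentiable ℝ g) :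
    wirtinger v (f * g) = f * wirtinger v g + wirtinger v f * g := by
  funext z
  simp only [wirtinger, fderiv_mul (hf z) (hg z), Pi.add_apply, Pi.mul_apply, add_apply,
    smul_apply, smul_eq_mul]
  ring

lemma wirtinger_eq_zero (v : E) (hf : Differentiable ℂ f) : wirtinger v f = 0 := by
  funext z
  have h : fderiv ℝ f z (Complex.I • v) = Complex.I * fderiv ℝ f z v := by
    rw [(hf z).fderiv_restrictScalars ℝ]
    exact (fderiv ℂ f z).map_smul Complex.I v
  rw [wirtinger, h, ← mul_assoc, Complex.I_mul_I, neg_one_mul, add_neg_cancel, mul_zero]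
  rfl

lemma wirtinger_sum_smul {ι : Type*} (s : Finset ι) (c : ι → ℂ) (v : ι → E) :
    wirtinger (∑ i ∈ s, c i • v i) f =
      ∑ i ∈ s, fun z => (starRingEnd ℂ) (c i) * wirtinger (v i) f z := by
  have hsmul : ∀ (c : ℂ) (v z : E), wirtinger (c • v) f z =
      (starRingEnd ℂ) c * wirtinger v f z := fun c v z => by
    have hc : c • v = c.re • v + c.im • Complex.I • v := by
      rw [← Complex.coe_smul, ← Complex.coe_smul, smul_smul, ← add_smul, Complex.re_add_im]
    have hIc : Complex.I • c • v = c.re • Complex.I • v - c.im • v := by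
      rw [hc, smul_add, smul_comm Complex.I, smul_comm Complex.I, smul_smul Complex.I,
        Complex.I_mul_I, neg_one_smul, smul_neg, sub_eq_add_neg]
    have hconj : (starRingEnd ℂ) c = c.re - c.im * Complex.I := by
      apply Complex.ext <;> simp
    simp only [wirtinger, hIc]
    rw [hc, hconj]
    simp only [map_add, map_sub, map_smul, Complex.real_smul]
    linear_combination (1 / 2 * (c.im : ℂ) * fderiv ℝ f z (Complex.I • v)) * Complex.I_mul_I
  funext z
  induction s using Finset.cons_induction with
  | empty => simp [wirtinger]
  | cons i s hi ih =>
    rw [Finset.sum_cons, Finset.sum_cons, Pi.add_apply, ← ih, ← hsmul]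
    simp only [wirtinger, smul_add, map_add]
    ring

lemma fderiv_wirtinger (v z u : E) (hf : ContDiff ℝ ∞ f) :
    fderiv ℝ (wirtinger v f) z u = 1 / 2 * (fderiv ℝ (fderiv ℝ f) z u v +
      Complex.I * fderiv ℝ (fderiv ℝ f) z u (Complex.I • v)) := by
  have hdf : DifferentiableAt ℝ (fderiv ℝ f) z :=
    (hf.fderiv_right (m := ∞) (by simp)).differentiable (by simp) z
  have hd : ∀ w : E, HasFDerivAt (fun y => fderiv ℝ f y w)
      ((fderiv ℝ (fderiv ℝ f) z).flip w) z := fun w => by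
    simpa using hdf.hasFDerivAt.clm_apply (hasFDerivAt_const w z)
  have hw : HasFDerivAt (wirtinger v f) _ z :=
    ((hd v).add ((hd (Complex.I • v)).const_mul Complex.I)).const_mul (1 / 2)
  rw [hw.fderiv]
  rfl

lemma wirtinger_comm (v w : E) (hf : ContDiff ℝ ∞ f) :
    wirtinger v (wirtinger w f) = wirtinger w (wirtinger v f) := by
  funext z
  have hsymm : ∀ u u' : E, fderiv ℝ (fderiv ℝ f) z u u' = fderiv ℝ (fderiv ℝ f) z u' u :=
    (hf.contDiffAt.isSymmSndFDerivAt (by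
      rw [minSmoothness_of_isRCLikeNormedField]; exact WithTop.coe_le_coe.2 le_top)).eq
  rw [wirtinger, wirtinger]
  simp only [fderiv_wirtinger _ _ _ hf]
  rw [hsymm v w, hsymm v (Complex.I • w), hsymm (Complex.I • v) w,
    hsymm (Complex.I • v) (Complex.I • w)]
  ring

lemma wirtinger_comp_affine (L : E' →L[ℂ] E) (a : E) (v : E') (hf : Differentiable ℝ f) :
    wirtinger v (fun w => f (L w + a)) = fun w => wirtinger (L v) f (L w + a) := by
  have hfd : ∀ w u : E', fderiv ℝ (fun w => f (L w + a)) w u = fderiv ℝ f (L w + a) (L u) :=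
    fun w u => by
      have hL : HasFDerivAt (fun w => L w + a) (L.restrictScalars ℝ) w :=
        (L.restrictScalars ℝ).hasFDerivAt.add_const a
      exact congrArg (· u) ((hf (L w + a)).hasFDerivAt.comp w hL).fderiv
  funext w
  simp only [wirtinger, hfd, map_smul]

end Wirtinger

/-- Polyanalyticity of order `m` on a complex normed space, without coordinates: `f` is smooth and
all its `m`-fold Wirtinger derivatives, in arbitrary directions, vanish. On `ℂⁿ` this is
`IsPolyanalytic m f`; the recursive form is the one that suits inductions on the order. -/
def PolyanalyticOfOrder {E : Type*} [NormedAddCommGroup E] [NormedSpace ℂ E] :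
    ℕ → (E → ℂ) → Prop
  | 0, f => f = 0
  | m + 1, f => ContDiff ℝ ∞ f ∧ ∀ v, PolyanalyticOfOrder m (wirtinger v f)

namespace PolyanalyticOfOrder

section NormedSpace

variable {E E' : Type*} [NormedAddCommGroup E] [NormedSpace ℂ E] [NormedAddCommGroup E']
  [NormedSpace ℂ E'] {f g : E → ℂ} {m : ℕ}

lemma contDiff (hf : PolyanalyticOfOrder m f) : ContDiff ℝ ∞ f := by
  cases m with
  | zero =>
    obtain rfl : f = 0 := hf
    exact contDiff_const
  | succ m => exact hf.1

lemma differentiable (hf : PolyanalyticOfOrder m f) : Differentiable ℝ f :=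
  hf.contDiff.differentiable (by simp)

lemma zero (m : ℕ) : PolyanalyticOfOrder m (0 : E → ℂ) := by
  induction m with
  | zero => rfl
  | succ m ih =>
    refine ⟨contDiff_const, fun v => ?_⟩
    rwa [wirtinger_eq_zero (f := 0) v (differentiable_const 0)]

lemma of_contDiff_complex (hf : ContDiff ℂ ∞ f) (m : ℕ) : PolyanalyticOfOrder (m + 1) f :=
  ⟨hf.restrict_scalars ℝ, fun v => by
    rw [wirtinger_eq_zero v (hf.differentiable (by simp))]
    exact zero m⟩

lemma add (hf : PolyanalyticOfOrder m f) (hg : PolyanalyticOfOrder m g) :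
    PolyanalyticOfOrder m (f + g) := by
  induction m generalizing f g with
  | zero =>
    obtain ⟨rfl, rfl⟩ : f = 0 ∧ g = 0 := ⟨hf, hg⟩
    exact add_zero 0
  | succ m ih =>
    refine ⟨hf.contDiff.add hg.contDiff, fun v => ?_⟩
    rw [wirtinger_add v hf.differentiable hg.differentiable]
    exact ih (hf.2 v) (hg.2 v)

lemma sum {ι : Type*} {s : Finset ι} {F : ι → E → ℂ}
    (hF : ∀ i ∈ s, PolyanalyticOfOrder m (F i)) : PolyanalyticOfOrder m (∑ i ∈ s, F i) :=
  Finset.sum_induction F _ (fun _ _ => add) (zero m) hF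

lemma succ (hf : PolyanalyticOfOrder m f) : PolyanalyticOfOrder (m + 1) f := by
  induction m generalizing f with
  | zero =>
    obtain rfl : f = 0 := hf
    exact zero 1
  | succ m ih => exact ⟨hf.contDiff, fun v => ih (hf.2 v)⟩

lemma mono {m' : ℕ} (h : m ≤ m') (hf : PolyanalyticOfOrder m f) : PolyanalyticOfOrder m' f :=
  Nat.le_induction hf (fun _ _ => succ) m' h

/-- Each factor absorbs at most as many derivatives as its order allows. -/
lemma mul {a b : ℕ} (hf : PolyanalyticOfOrder (a + 1) f) (hg : PolyanalyticOfOrder (b + 1) g) :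
    PolyanalyticOfOrder (a + b + 1) (f * g) := by
  induction hs : a + b generalizing a b f g with
  | zero =>
    obtain ⟨rfl, rfl⟩ : a = 0 ∧ b = 0 := by omega
    refine ⟨hf.contDiff.mul hg.contDiff, fun v => ?_⟩
    have hf0 : wirtinger v f = 0 := hf.2 v
    have hg0 : wirtinger v g = 0 := hg.2 v
    rw [wirtinger_mul v hf.differentiable hg.differentiable, hf0, hg0, mul_zero, zero_mul, add_zero]
    exact zero 0
  | succ s ih =>
    refine ⟨hf.contDiff.mul hg.contDiff, fun v => ?_⟩
    rw [wirtinger_mul v hf.differentiable hg.differentiable]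
    refine add ?_ ?_
    · cases b with
      | zero =>
        have hg0 : wirtinger v g = 0 := hg.2 v
        rw [hg0, mul_zero]
        exact zero _
      | succ b => exact ih hf (hg.2 v) (by omega)
    · cases a with
      | zero =>
        have hf0 : wirtinger v f = 0 := hf.2 v
        rw [hf0, zero_mul]
        exact zero _
      | succ a => exact ih (hf.2 v) hg (by omega)

lemma const_mul (c : ℂ) (hf : PolyanalyticOfOrder m f) :
    PolyanalyticOfOrder m fun z => c * f z := by
  cases m with
  | zero =>
    obtain rfl : f = 0 := hf
    exact funext fun _ => mul_zero c
  | succ m => exact zero_add m ▸ (of_contDiff_complex (contDiff_const (c := c)) 0).mul hf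

lemma pow (hf : PolyanalyticOfOrder (m + 1) f) (i : ℕ) :
    PolyanalyticOfOrder (m * i + 1) (f ^ i) := by
  induction i with
  | zero => exact of_contDiff_complex contDiff_const _
  | succ i ih => exact ih.mul hf

lemma comp_affine (L : E' →L[ℂ] E) (a : E) (hf : PolyanalyticOfOrder m f) :
    PolyanalyticOfOrder m fun w => f (L w + a) := by
  induction m generalizing f with
  | zero =>
    obtain rfl : f = 0 := hf
    rfl
  | succ m ih =>
    refine ⟨hf.contDiff.comp ((L.restrictScalars ℝ).contDiff.add contDiff_const), fun v => ?_⟩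
    rw [wirtinger_comp_affine L a v hf.differentiable]
    exact ih (hf.2 (L v))

end NormedSpace

section InnerProductSpace

variable {E : Type*} [NormedAddCommGroup E] [InnerProductSpace ℂ E]

lemma norm_sub_sq (z : E) :
    PolyanalyticOfOrder 2 fun w => ((‖w - z‖ ^ 2 : ℝ) : ℂ) := by
  let _ : InnerProductSpace ℝ E := InnerProductSpace.rclikeToReal ℂ E
  have hsmooth : ContDiff ℝ ∞ fun w => ((‖w - z‖ ^ 2 : ℝ) : ℂ) :=
    Complex.ofRealCLM.contDiff.comp ((contDiff_id.sub contDiff_const).norm_sq ℝ)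
  refine ⟨hsmooth, fun v => ?_⟩
  have hfd : ∀ w u, fderiv ℝ (fun w => ((‖w - z‖ ^ 2 : ℝ) : ℂ)) w u =
      2 * ((inner ℂ (w - z) u).re : ℂ) := fun w u => by
    have h := Complex.ofRealCLM.hasFDerivAt.comp w ((hasFDerivAt_id w).sub_const z).norm_sq
    refine (congrArg (· u) h.fderiv).trans ?_
    simp [real_inner_eq_re_inner ℂ]
  have hinner : wirtinger v (fun w => ((‖w - z‖ ^ 2 : ℝ) : ℂ)) = fun w => inner ℂ v (w - z) := by
    funext w
    rw [wirtinger, hfd, hfd, inner_smul_right, ← inner_conj_symm v]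
    generalize inner ℂ (w - z) v = c
    apply Complex.ext <;> simp
  rw [hinner]
  exact of_contDiff_complex
    ((innerSL ℂ v).contDiff.comp (contDiff_id.sub contDiff_const)) 0

lemma laguerre_norm_sub_sq (a p : ℕ) (z : E) :
    PolyanalyticOfOrder (p + 1) fun w => (laguerre a p (‖w - z‖ ^ 2) : ℂ) := by
  have h : (fun w => (laguerre a p (‖w - z‖ ^ 2) : ℂ)) = ∑ i ∈ Finset.range (p + 1),
      fun w => ((-1) ^ i * ((p + a).choose (p - i) : ℂ) / (i.factorial : ℂ)) *
        ((fun w => ((‖w - z‖ ^ 2 : ℝ) : ℂ)) ^ i) w := by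
    funext w
    simp only [laguerre, Finset.sum_apply, Pi.pow_apply]
    push_cast
    exact Finset.sum_congr rfl fun i _ => by ring
  rw [h]
  refine sum fun i hi => const_mul _ (mono ?_ ((norm_sub_sq z).pow i))
  have := Finset.mem_range.1 hi
  omega

end InnerProductSpace

end PolyanalyticOfOrder

section Coordinates

variable {n m : ℕ} {f : (Fin n → ℂ) → ℂ}

lemma iterate_dbar_dbar (r s : Fin n) (j : ℕ) (hf : ContDiff ℝ ∞ f) :
    (dbar s)^[j] (dbar r f) = dbar r ((dbar s)^[j] f) := by
  induction j generalizing f with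
  | zero => rfl
  | succ j ih =>
    have hcomm : dbar s (dbar r f) = dbar r (dbar s f) := by
      rw [dbar_eq_wirtinger, dbar_eq_wirtinger, wirtinger_comm _ _ hf]
    rw [Function.iterate_succ_apply, Function.iterate_succ_apply, hcomm, ih (contDiff_dbar s hf)]

lemma foldr_dbar_dbar (k : Fin n → ℕ) (l : List (Fin n)) (r : Fin n) (hf : ContDiff ℝ ∞ f) :
    l.foldr (fun s g => (dbar s)^[k s] g) (dbar r f) =
      dbar r (l.foldr (fun s g => (dbar s)^[k s] g) f) := by
  induction l with
  | nil => rfl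
  | cons s l ih =>
    rw [List.foldr_cons, List.foldr_cons, ih, iterate_dbar_dbar r s _ ((foldr_dbar k l).1 f hf)]

lemma dbarPow_zero (f : (Fin n → ℂ) → ℂ) : dbarPow 0 f = f := by
  unfold dbarPow
  induction List.finRange n with
  | nil => rfl
  | cons _ _ ih => exact ih

lemma dbarPow_dbar (k : Fin n → ℕ) (r : Fin n) (hf : ContDiff ℝ ∞ f) :
    dbarPow k (dbar r f) = dbarPow (k + Pi.single r 1) f := by
  have hfold : ∀ l : List (Fin n), l.Nodup → r ∈ l →
      l.foldr (fun s g => (dbar s)^[k s] g) (dbar r f) =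
        l.foldr (fun s g => (dbar s)^[(k + Pi.single r 1 : Fin n → ℕ) s] g) f := fun l hl hr => by
    induction l with
    | nil => simp at hr
    | cons s l ih =>
      obtain ⟨hs, hl⟩ := List.nodup_cons.1 hl
      rw [List.foldr_cons, List.foldr_cons]
      obtain rfl | hr := List.mem_cons.1 hr
      · have htail : l.foldr (fun s g => (dbar s)^[(k + Pi.single r 1 : Fin n → ℕ) s] g) f =
            l.foldr (fun s g => (dbar s)^[k s] g) f :=
          List.foldr_ext _ _ _ fun s hsl g => by
            rw [Pi.add_apply, Pi.single_eq_of_ne (ne_of_mem_of_not_mem hsl hs), add_zero]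
        rw [htail, foldr_dbar_dbar k l r hf, Pi.add_apply, Pi.single_eq_same,
          Function.iterate_succ_apply]
      · rw [ih hl hr, Pi.add_apply, Pi.single_eq_of_ne (ne_of_mem_of_not_mem hr hs).symm, add_zero]
  exact hfold _ (List.nodup_finRange n) (List.mem_finRange r)

lemma isPolyanalytic_zero_iff : IsPolyanalytic 0 f ↔ f = 0 := by
  refine ⟨fun hf => dbarPow_zero f ▸ hf.2 0 (by simp), ?_⟩
  rintro rfl
  refine ⟨contDiff_const, fun k hk => ?_⟩
  obtain rfl : k = 0 := funext fun r => Finset.sum_eq_zero_iff.1 hk r (Finset.mem_univ r)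
  exact dbarPow_zero 0

lemma isPolyanalytic_succ_iff :
    IsPolyanalytic (m + 1) f ↔ ContDiff ℝ ∞ f ∧ ∀ r, IsPolyanalytic m (dbar r f) := by
  refine and_congr_right fun hf => ⟨fun h r => ⟨contDiff_dbar r hf, fun k hk => ?_⟩,
    fun h k hk => ?_⟩
  · rw [dbarPow_dbar k r hf]
    refine h _ ?_
    simp only [Pi.add_apply, Finset.sum_add_distrib, hk, Finset.sum_pi_single', Finset.mem_univ,
      if_true]
  · obtain ⟨r, -, hr⟩ : ∃ r ∈ Finset.univ, k r ≠ 0 :=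
      Finset.exists_ne_zero_of_sum_ne_zero (by omega)
    obtain ⟨k, rfl⟩ : ∃ k' : Fin n → ℕ, k = k' + Pi.single r 1 :=
      ⟨k - Pi.single r 1, (tsub_add_cancel_of_le fun s => by
        obtain rfl | hs := eq_or_ne s r <;> simp [*, Nat.one_le_iff_ne_zero]).symm⟩
    rw [← dbarPow_dbar _ r hf]
    refine (h r).2 k ?_
    simpa only [Pi.add_apply, Finset.sum_add_distrib, Finset.sum_pi_single', Finset.mem_univ,
      if_true, add_left_inj] using hk

lemma wirtinger_eq_sum_dbar (v : Fin n → ℂ) (f : (Fin n → ℂ) → ℂ) :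
    wirtinger v f = ∑ r, fun z => (starRingEnd ℂ) (v r) * dbar r f z := by
  conv_lhs => rw [pi_eq_sum_univ' v, wirtinger_sum_smul]
  simp only [dbar_eq_wirtinger]

lemma isPolyanalytic_iff_polyanalyticOfOrder : IsPolyanalytic m f ↔ PolyanalyticOfOrder m f := by
  induction m generalizing f with
  | zero => exact isPolyanalytic_zero_iff
  | succ m ih =>
    refine isPolyanalytic_succ_iff.trans (and_congr_right fun _ => ?_)
    simp only [ih]
    refine ⟨fun h v => ?_, fun h r => dbar_eq_wirtinger r ▸ h (Pi.single r 1)⟩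
    rw [wirtinger_eq_sum_dbar]
    exact .sum fun r _ => .const_mul _ (h r)

end Coordinates

section OneVariable

variable {f : ℂ → ℂ} {m : ℕ}

lemma differentiable_complex_of_wirtinger_eq_zero (hf : Differentiable ℝ f)
    (h : wirtinger 1 f = 0) : Differentiable ℂ f := fun z => by
  refine differentiableAt_complex_iff_differentiableAt_real.2 ⟨hf z, ?_⟩
  have hz : wirtinger 1 f z = 0 := congrFun h z
  rw [wirtinger, smul_eq_mul, mul_one] at hz
  rw [smul_eq_mul]
  linear_combination (-2 * Complex.I) * hz + fderiv ℝ f z Complex.I * Complex.I_mul_I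

lemma contDiff_conj_pow_mul (j : ℕ) (hf : Differentiable ℂ f) :
    ContDiff ℝ ∞ fun z => (starRingEnd ℂ) z ^ j * f z :=
  (Complex.conjCLE.contDiff.pow j).mul (hf.contDiff.restrict_scalars ℝ)

lemma wirtinger_conj_pow_mul (j : ℕ) (hf : Differentiable ℂ f) :
    wirtinger 1 (fun z => (starRingEnd ℂ) z ^ (j + 1) * f z) =
      fun z => (j + 1) * ((starRingEnd ℂ) z ^ j * f z) := by
  have hconj : ∀ z, HasFDerivAt (fun z => (starRingEnd ℂ) z ^ (j + 1)) _ z := fun z =>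
    (Complex.conjCLE.toContinuousLinearMap.hasFDerivAt (x := z)).pow (j + 1)
  have hpow : wirtinger 1 (fun z => (starRingEnd ℂ) z ^ (j + 1)) =
      fun z => (j + 1) * (starRingEnd ℂ) z ^ j := by
    funext z
    rw [wirtinger, (hconj z).fderiv]
    simp only [nsmul_eq_mul, smul_apply, smul_eq_mul, mul_one, add_tsub_cancel_right,
      ContinuousLinearEquiv.coe_coe, Complex.conjCLE_apply, map_one, Complex.conj_I]
    push_cast
    linear_combination (-(1 / 2) * (j + 1) * (starRingEnd ℂ) z ^ j) * Complex.I_mul_I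
  refine (wirtinger_mul 1 (fun z => (hconj z).differentiableAt)
    (hf.restrictScalars ℝ)).trans ?_
  rw [hpow, wirtinger_eq_zero 1 hf, mul_zero, zero_add]
  funext z
  exact mul_assoc _ _ _

/-- Dividing by `j + 1` the `j`-th coefficient of the expansion of the Wirtinger derivative gives
the expansion up to an entire function. -/
lemma PolyanalyticOfOrder.exists_eq_sum_conj_pow_mul (hf : PolyanalyticOfOrder m f) :
    ∃ h : ℕ → ℂ → ℂ, (∀ j, Differentiable ℂ (h j)) ∧
      f = ∑ j ∈ Finset.range m, fun z => (starRingEnd ℂ) z ^ j * h j z := by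
  induction m generalizing f with
  | zero => exact ⟨0, fun _ => differentiable_const 0, hf⟩
  | succ m ih =>
    obtain ⟨h, hh, hsum⟩ := ih (hf.2 1)
    have hh' : ∀ j : ℕ, Differentiable ℂ fun z => (j + 1 : ℂ)⁻¹ * h j z := fun j =>
      (hh j).const_mul _
    set G : ℂ → ℂ := ∑ j ∈ Finset.range m,
      fun z => (starRingEnd ℂ) z ^ (j + 1) * ((j + 1 : ℂ)⁻¹ * h j z)
    have hterm : ∀ j : ℕ, Differentiable ℝ
        fun z => (starRingEnd ℂ) z ^ (j + 1) * ((j + 1 : ℂ)⁻¹ * h j z) := fun j =>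
      (contDiff_conj_pow_mul (j + 1) (hh' j)).differentiable (by simp)
    have hGd : Differentiable ℝ G := Differentiable.sum fun j _ => hterm j
    have hdG : wirtinger 1 G = wirtinger 1 f := by
      rw [hsum, wirtinger_sum _ _ fun j _ => hterm j]
      refine Finset.sum_congr rfl fun j _ => ?_
      rw [wirtinger_conj_pow_mul j (hh' j)]
      funext z
      have : (j + 1 : ℂ) ≠ 0 := Nat.cast_add_one_ne_zero j
      field_simp
    have hentire : Differentiable ℂ (f - G) :=
      differentiable_complex_of_wirtinger_eq_zero (hf.differentiable.sub hGd) <| by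
        rw [wirtinger_sub 1 hf.differentiable hGd, hdG, sub_self]
    refine ⟨fun j => Nat.casesOn j (f - G) fun j z => (j + 1 : ℂ)⁻¹ * h j z,
      fun j => by cases j <;> simp [hentire, hh'], ?_⟩
    rw [Finset.sum_range_succ']
    simp only [pow_zero, one_mul]
    exact (add_sub_cancel G f).symm

/-- On the circle `|z| = t` one has `z̄ = t² / z`, so this is Cauchy's formula for derivatives. -/
lemma circleAverage_conj_pow_mul (j : ℕ) (hf : Differentiable ℂ f) {t : ℝ} (ht : 0 < t) :
    Real.circleAverage (fun z => (starRingEnd ℂ) z ^ j * f z) 0 t =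
      iteratedDeriv j f 0 / j.factorial * t ^ (2 * j) := by
  have hcauchy :=
    (hf.diffContOnCl (s := Metric.ball 0 t)).circleIntegral_one_div_sub_center_pow_smul ht j
  have hintegral : (∮ z in C(0, t), (z - 0)⁻¹ • ((starRingEnd ℂ) z ^ j * f z)) =
      ∮ z in C(0, t), (t : ℂ) ^ (2 * j) • (1 / (z - 0) ^ (j + 1)) • f z := by
    refine circleIntegral.integral_congr ht.le fun z hz => ?_
    have hnorm : ‖z‖ = t := by simpa using hz
    have hz0 : z ≠ 0 := norm_pos_iff.1 (hnorm ▸ ht)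
    have hconj : (starRingEnd ℂ) z = t ^ 2 / z := by
      rw [eq_div_iff hz0, mul_comm, Complex.mul_conj', hnorm]
    simp only [hconj, sub_zero, smul_eq_mul, pow_mul, div_pow]
    field_simp
    ring
  rw [Real.circleAverage_eq_circleIntegral ht.ne', hintegral, circleIntegral.integral_smul,
    hcauchy]
  have : (j.factorial : ℂ) ≠ 0 := Nat.cast_ne_zero.2 j.factorial_ne_zero
  simp only [smul_eq_mul]
  field_simp

lemma PolyanalyticOfOrder.exists_circleAverage_eq (hf : PolyanalyticOfOrder (m + 1) f) :
    ∃ a : ℕ → ℂ, a 0 = f 0 ∧ ∀ t : ℝ, 0 < t →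
      Real.circleAverage f 0 t = ∑ l ∈ Finset.range (m + 1), a l * t ^ (2 * l) := by
  obtain ⟨h, hh, rfl⟩ := hf.exists_eq_sum_conj_pow_mul
  refine ⟨fun l => iteratedDeriv l (h l) 0 / l.factorial, ?_, fun t ht => ?_⟩
  · simp [Finset.sum_range_succ']
  · rw [Real.circleAverage_sum fun j _ =>
      (contDiff_conj_pow_mul j (hh j)).continuous.continuousOn.circleIntegrable ht.le]
    exact Finset.sum_congr rfl fun j _ => circleAverage_conj_pow_mul j (hh j) ht

end OneVariable

section Polar

variable {E F : Type*} [NormedAddCommGroup E] [MeasurableSpace E] [BorelSpace E]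
  [NormedAddCommGroup F] [NormedSpace ℝ F]

lemma integral_volumeIoiPow (k : ℕ) (g : ℝ → F) :
    ∫ t : Set.Ioi (0 : ℝ), g t ∂(Measure.volumeIoiPow k) = ∫ t in Set.Ioi (0 : ℝ), t ^ k • g t := by
  simp only [Measure.volumeIoiPow, ENNReal.ofReal]
  rw [integral_withDensity_eq_integral_smul (measurable_subtype_coe.pow_const _).real_toNNReal,
    integral_subtype_comap measurableSet_Ioi fun a ↦ Real.toNNReal (a ^ k) • g a]
  refine setIntegral_congr_fun measurableSet_Ioi fun t ht => ?_
  simp only [NNReal.smul_def, Real.coe_toNNReal _ (pow_nonneg (le_of_lt ht) _)]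

lemma integral_eq_zero_of_radial [NormedSpace ℝ E] [FiniteDimensional ℝ E] [Nontrivial E]
    (μ : Measure E) [μ.IsAddHaarMeasure] {g : E → F}
    (h : ∀ u : E, ‖u‖ = 1 →
      ∫ t in Set.Ioi (0 : ℝ), t ^ (Module.finrank ℝ E - 1) • g (t • u) = 0) :
    ∫ w, g w ∂μ = 0 := by
  have hpolar : ∫ w, g w ∂μ = ∫ p : Metric.sphere (0 : E) 1 × Set.Ioi (0 : ℝ),
      g (p.2.1 • p.1.1) ∂(μ.toSphere.prod (Measure.volumeIoiPow (Module.finrank ℝ E - 1))) :=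
    calc ∫ w, g w ∂μ = ∫ x : ({0}ᶜ : Set E), g x ∂(μ.comap (↑)) := by
          rw [integral_subtype_comap (measurableSet_singleton (0 : E)).compl g,
            restrict_compl_singleton]
      _ = _ := by
          rw [← μ.measurePreserving_homeomorphUnitSphereProd.integral_comp
            (homeomorphUnitSphereProd E).measurableEmbedding]
          refine integral_congr_ae (.of_forall fun x => ?_)
          have hx : ‖x.1‖ ≠ 0 := norm_ne_zero_iff.2 x.2
          simp [smul_smul, mul_inv_cancel₀ hx]
  rw [hpolar]
  by_cases hint : Integrable (fun p : Metric.sphere (0 : E) 1 × Set.Ioi (0 : ℝ) =>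
      g (p.2.1 • p.1.1))
      (μ.toSphere.prod (Measure.volumeIoiPow (Module.finrank ℝ E - 1)))
  · rw [integral_prod _ hint]
    refine integral_eq_zero_of_ae (.of_forall fun u => ?_)
    exact (integral_volumeIoiPow _ fun t => g (t • (u : E))).trans (h u (by simp))
  · exact integral_undef hint

end Polar

section Rotation

variable {E F : Type*} [NormedAddCommGroup E] [NormedSpace ℂ E] [FiniteDimensional ℂ E]
  [MeasurableSpace E] [BorelSpace E] [NormedAddCommGroup F] [NormedSpace ℝ F]
  (μ : Measure E) [μ.IsAddHaarMeasure]

lemma measurePreserving_smul_of_norm_eq_one {c : ℂ} (hc : ‖c‖ = 1) :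
    MeasurePreserving (fun w : E => c • w) μ μ := by
  refine ⟨measurable_const_smul c, ?_⟩
  have hdet : LinearMap.det ((c • LinearMap.id : E →ₗ[ℂ] E).restrictScalars ℝ) = 1 := by
    rw [LinearMap.det_restrictScalars, LinearMap.det_smul, LinearMap.det_id, mul_one, map_pow,
      Algebra.norm_complex_apply, Complex.normSq_eq_norm_sq, hc, one_pow, one_pow]
  have hmap := Measure.map_linearMap_addHaar_eq_smul_addHaar μ (hdet ▸ one_ne_zero)
  rw [hdet, inv_one, abs_one, ENNReal.ofReal_one, one_smul] at hmap
  exact hmap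

lemma integral_smul_of_norm_eq_one {c : ℂ} (hc : ‖c‖ = 1) (g : E → F) :
    ∫ w, g (c • w) ∂μ = ∫ w, g w ∂μ :=
  (measurePreserving_smul_of_norm_eq_one μ hc).integral_comp
    (Homeomorph.smulOfNeZero c (norm_ne_zero_iff.1 (hc ▸ one_ne_zero))).measurableEmbedding g

lemma integral_circleAverage_smul [CompleteSpace F] {g : E → F} (hg : Continuous g)
    (hint : Integrable g μ) :
    ∫ w, Real.circleAverage (fun ζ => g (ζ • w)) 0 1 ∂μ = ∫ w, g w ∂μ := by
  have hnorm : ∀ θ, ‖circleMap 0 1 θ‖ = 1 := fun θ => by simp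
  have hprod : Integrable (fun p : ℝ × E => g (circleMap 0 1 p.1 • p.2))
      ((volume.restrict (Set.Ioc 0 (2 * Real.pi))).prod μ) := by
    have hcont : Continuous fun p : ℝ × E => g (circleMap 0 1 p.1 • p.2) := by fun_prop
    refine (integrable_prod_iff hcont.aestronglyMeasurable).2 ⟨.of_forall fun θ =>
      (measurePreserving_smul_of_norm_eq_one μ (hnorm θ)).integrable_comp_of_integrable hint, ?_⟩
    simp only [integral_smul_of_norm_eq_one μ (hnorm _) fun w => ‖g w‖]
    exact integrable_const _
  simp only [Real.circleAverage_def, intervalIntegral.integral_of_le Real.two_pi_pos.le]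
  rw [integral_smul, ← integral_integral_swap hprod]
  simp only [integral_smul_of_norm_eq_one μ (hnorm _) g]
  rw [setIntegral_const, Real.volume_real_Ioc_of_le Real.two_pi_pos.le, sub_zero, smul_smul,
    inv_mul_cancel₀ Real.two_pi_pos.ne', one_smul]

end Rotation

/-- A profile `χ` such that the radial weight `w ↦ χ (‖w‖²)` is orthogonal to `‖w‖²`, …, `‖w‖²ᵐ`.
Integrating against such a weight evaluates functions polyanalytic of order `m + 1` at `0`, up to
the factor `∫ χ (‖w‖²)`. -/
structure IsReproducingProfile {E : Type*} [NormedAddCommGroup E] [MeasurableSpace E]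
    (μ : Measure E) (m : ℕ) (χ : ℝ → ℝ) : Prop where
  continuous : Continuous χ
  integrable_moment : ∀ l ≤ m, Integrable (fun w => ‖w‖ ^ (2 * l) * χ (‖w‖ ^ 2)) μ
  moment_eq_zero : ∀ l, 1 ≤ l → l ≤ m → ∫ w, ‖w‖ ^ (2 * l) * χ (‖w‖ ^ 2) ∂μ = 0

namespace IsReproducingProfile

lemma integrable {E : Type*} [NormedAddCommGroup E] [MeasurableSpace E] {μ : Measure E} {m : ℕ}
    {χ : ℝ → ℝ} (hχ : IsReproducingProfile μ m χ) : Integrable (fun w => χ (‖w‖ ^ 2)) μ := by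
  simpa only [mul_zero, pow_zero, one_mul] using hχ.integrable_moment 0 m.zero_le

section Radius

variable {E : Type*} [NormedAddCommGroup E] [NormedSpace ℝ E] [FiniteDimensional ℝ E]
  [Nontrivial E] [MeasurableSpace E] [BorelSpace E] {μ : Measure E} [μ.IsAddHaarMeasure] {m l : ℕ}
  {χ : ℝ → ℝ}

lemma integrableOn_radius (hχ : IsReproducingProfile μ m χ) (hl : l ≤ m) :
    IntegrableOn (fun t : ℝ => t ^ (Module.finrank ℝ E - 1) * (t ^ (2 * l) * χ (t ^ 2)))
      (Set.Ioi 0) :=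
  (integrable_fun_norm_addHaar μ).1 (hχ.integrable_moment l hl)

lemma integral_radius_eq_zero (hχ : IsReproducingProfile μ m χ) (hl₁ : 1 ≤ l) (hl : l ≤ m) :
    ∫ t in Set.Ioi (0 : ℝ), t ^ (Module.finrank ℝ E - 1) * (t ^ (2 * l) * χ (t ^ 2)) = 0 := by
  have h := hχ.moment_eq_zero l hl₁ hl
  rw [integral_fun_norm_addHaar μ fun t => t ^ (2 * l) * χ (t ^ 2)] at h
  have hball : μ.real (Metric.ball 0 1) ≠ 0 :=
    (ENNReal.toReal_pos (Metric.measure_ball_pos μ 0 one_pos).ne' measure_ball_lt_top.ne).ne'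
  simpa [hball, Module.finrank_pos.ne'] using h

end Radius

section Reproduction

variable {E : Type*} [NormedAddCommGroup E] [NormedSpace ℂ E]

lemma exists_circleAverage_mul_sub_eq (χ : ℝ → ℝ) {m : ℕ} {F : E → ℂ}
    (hF : PolyanalyticOfOrder (m + 1) F) {u : E} (hu : ‖u‖ = 1) :
    ∃ a : ℕ → ℂ, ∀ t : ℝ, 0 < t → Real.circleAverage (fun ζ : ℂ =>
      F (ζ • t • u) * χ (‖ζ • t • u‖ ^ 2) - F 0 * χ (‖ζ • t • u‖ ^ 2)) 0 1 =
      ∑ l ∈ Finset.range m, a l * (t ^ (2 * (l + 1)) * χ (t ^ 2) : ℝ) := by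
  obtain ⟨a, ha0, ha⟩ := (hF.comp_affine (.toSpanSingleton ℂ u) 0).exists_circleAverage_eq
  simp only [ContinuousLinearMap.toSpanSingleton_apply, zero_smul, add_zero] at ha0 ha
  refine ⟨fun l => a (l + 1), fun t ht => ?_⟩
  calc _ = Real.circleAverage (fun ζ : ℂ => (χ (t ^ 2) : ℂ) • (F (ζ • u) - F 0)) 0 t := by
        rw [Real.circleAverage_eq_circleAverage_zero_one (R := t)]
        refine Real.circleAverage_congr_sphere fun ζ hζ => ?_
        have hζ : ‖ζ‖ = 1 := by simpa using hζ
        have hnorm : ‖ζ • t • u‖ = t := by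
          rw [norm_smul, norm_smul, hζ, hu, one_mul, mul_one, Real.norm_of_nonneg ht.le]
        have hsmul : ζ • t • u = (t * ζ + 0 : ℂ) • u := by
          rw [add_zero, mul_comm, mul_smul, Complex.coe_smul]
        simp only [hnorm, smul_eq_mul]
        rw [hsmul]
        ring
    _ = χ (t ^ 2) * (Real.circleAverage (fun ζ : ℂ => F (ζ • u)) 0 t - F 0) := by
        have hline : Continuous fun ζ : ℂ => F (ζ • u) :=
          hF.contDiff.continuous.comp (by fun_prop)
        rw [Real.circleAverage_fun_smul, Real.circleAverage_fun_sub
          (hline.continuousOn.circleIntegrable ht.le) (circleIntegrable_const _ _ _),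
          Real.circleAverage_const, smul_eq_mul]
    _ = _ := by
        rw [ha t ht, Finset.sum_range_succ', ha0, mul_zero, pow_zero, mul_one,
          add_sub_cancel_right, Finset.mul_sum]
        refine Finset.sum_congr rfl fun l _ => ?_
        push_cast
        ring

variable [FiniteDimensional ℂ E] [Nontrivial E] [MeasurableSpace E] [BorelSpace E] {μ : Measure E}
  [μ.IsAddHaarMeasure] {m : ℕ} {χ : ℝ → ℝ}

/-- Rotation invariance replaces `F` by its averages over the circles centred at `0` in the
complex lines, which are polynomials in the squared radius with constant term `F 0`. -/
lemma integral_mul (hχ : IsReproducingProfile μ m χ) {F : E → ℂ}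
    (hF : PolyanalyticOfOrder (m + 1) F) (hint : Integrable (fun w => F w * χ (‖w‖ ^ 2)) μ) :
    ∫ w, F w * χ (‖w‖ ^ 2) ∂μ = F 0 * ∫ w, χ (‖w‖ ^ 2) ∂μ := by
  have hχint : Integrable (fun w => F 0 * (χ (‖w‖ ^ 2) : ℂ)) μ := hχ.integrable.ofReal.const_mul _
  have hcont : Continuous fun w => F w * χ (‖w‖ ^ 2) - F 0 * χ (‖w‖ ^ 2) := by
    have := hF.contDiff.continuous
    have := hχ.continuous
    fun_prop
  rw [← integral_complex_ofReal, ← integral_const_mul, ← sub_eq_zero, ← integral_sub hint hχint,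
    ← integral_circleAverage_smul μ hcont (hint.sub hχint)]
  refine integral_eq_zero_of_radial μ fun u hu => ?_
  obtain ⟨a, ha⟩ := exists_circleAverage_mul_sub_eq χ hF hu
  calc _ = ∫ t in Set.Ioi (0 : ℝ), ∑ l ∈ Finset.range m, a l *
        ((t ^ (Module.finrank ℝ E - 1) * (t ^ (2 * (l + 1)) * χ (t ^ 2)) : ℝ) : ℂ) := by
        refine setIntegral_congr_fun measurableSet_Ioi fun t ht => ?_
        simp only [ha t ht, Finset.smul_sum, Complex.real_smul, Complex.ofReal_mul]
        exact Finset.sum_congr rfl fun l _ => by ring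
    _ = ∑ l ∈ Finset.range m, a l * (0 : ℝ) := by
        rw [integral_finsetSum _ fun l hl =>
          ((hχ.integrableOn_radius (Finset.mem_range.1 hl)).ofReal.const_mul _)]
        refine Finset.sum_congr rfl fun l hl => ?_
        rw [integral_const_mul, integral_complex_ofReal,
          hχ.integral_radius_eq_zero l.succ_pos (Finset.mem_range.1 hl)]
    _ = 0 := by simp

end Reproduction

end IsReproducingProfile

section LaguerreMoments

lemma sum_laguerre_coeff_mul_ascFactorial (a : ℕ) {l p : ℕ} (hl : l ≤ p) :
    ∑ i ∈ Finset.range (p + 1), (-1 : ℝ) ^ i * (p + a).choose (p - i) / i.factorial *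
      a.ascFactorial (l + i) = a.ascFactorial l * (p - l).choose p := by
  have hterm : ∀ i, ((-1 : ℝ) ^ i * (p + a).choose (p - i) / i.factorial * a.ascFactorial (l + i)) =
      a.ascFactorial l * ((Ring.choose (-((a + l : ℕ) : ℤ)) i *
        Ring.choose ((p + a : ℕ) : ℤ) (p - i) : ℤ) : ℝ) := fun i => by
    have hfac : (i.factorial : ℝ) ≠ 0 := by exact_mod_cast i.factorial_ne_zero
    have hmultichoose : Ring.multichoose ((a + l : ℕ) : ℤ) i = ((a + l + i - 1).choose i : ℤ) := rfl
    rw [← Nat.ascFactorial_mul_ascFactorial, Nat.ascFactorial_eq_factorial_mul_choose' (a + l),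
      Ring.choose_neg', Ring.choose_natCast, hmultichoose]
    simp only [Units.smul_def, Int.coe_negOnePow_natCast, smul_eq_mul]
    push_cast
    field_simp
  have hvandermonde := Ring.add_choose_eq p (Commute.all (-((a + l : ℕ) : ℤ)) ((p + a : ℕ) : ℤ))
  rw [Finset.Nat.sum_antidiagonal_eq_sum_range_succ_mk,
    show -((a + l : ℕ) : ℤ) + ((p + a : ℕ) : ℤ) = ((p - l : ℕ) : ℤ) by omega,
    Ring.choose_natCast] at hvandermonde
  simp only [hterm]
  rw [← Finset.mul_sum, ← Int.cast_sum, ← hvandermonde, Int.cast_natCast]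

lemma integrable_norm_pow_mul_exp {E : Type*} [NormedAddCommGroup E] [NormedSpace ℝ E]
    [Nontrivial E] [FiniteDimensional ℝ E] [MeasurableSpace E] [BorelSpace E] (μ : Measure E)
    [μ.IsAddHaarMeasure] (k : ℕ) :
    Integrable (fun w => ‖w‖ ^ k * Real.exp (-‖w‖ ^ 2)) μ := by
  refine (integrable_fun_norm_addHaar (f := fun t => t ^ k * Real.exp (-t ^ 2)) μ).2 ?_
  have h := integrableOn_rpow_mul_exp_neg_rpow (p := 2) (s := (Module.finrank ℝ E - 1 + k : ℕ))
    (by linarith [(Nat.cast_nonneg (Module.finrank ℝ E - 1 + k) : (0 : ℝ) ≤ _)]) (by norm_num)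
  simp only [Real.rpow_natCast, Real.rpow_ofNat, pow_add, mul_assoc] at h
  exact h

lemma integral_Ioi_odd_pow_mul_exp_neg_sq (k : ℕ) :
    ∫ t in Set.Ioi (0 : ℝ), t ^ (2 * k + 1) * Real.exp (-t ^ 2) = k.factorial / 2 := by
  have h := integral_rpow_mul_exp_neg_rpow (p := 2) (q := ((2 * k + 1 : ℕ) : ℝ)) (by norm_num)
    (by linarith [(Nat.cast_nonneg (2 * k + 1) : (0 : ℝ) ≤ (2 * k + 1 : ℕ))])
  have hexp : (((2 * k + 1 : ℕ) : ℝ) + 1) / 2 = k + 1 := by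
    push_cast
    ring
  rw [hexp, Real.Gamma_nat_eq_factorial] at h
  simp only [Real.rpow_natCast, Real.rpow_ofNat] at h
  rw [h]
  ring

variable {E : Type*} [NormedAddCommGroup E] [NormedSpace ℂ E] [FiniteDimensional ℂ E]
  [Nontrivial E] [MeasurableSpace E] [BorelSpace E] (μ : Measure E) [μ.IsAddHaarMeasure]

lemma integral_norm_pow_mul_exp (l : ℕ) :
    ∫ w, ‖w‖ ^ (2 * l) * Real.exp (-‖w‖ ^ 2) ∂μ =
      (Module.finrank ℂ E).ascFactorial l * ∫ w, Real.exp (-‖w‖ ^ 2) ∂μ := by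
  obtain ⟨n, hn⟩ : ∃ n, Module.finrank ℂ E = n + 1 :=
    Nat.exists_eq_succ_of_ne_zero Module.finrank_pos.ne'
  have hradial : ∀ j, ∫ w, ‖w‖ ^ (2 * j) * Real.exp (-‖w‖ ^ 2) ∂μ =
      Module.finrank ℝ E • μ.real (Metric.ball 0 1) • ((n + j).factorial / 2 : ℝ) := fun j => by
    have hpow : ∀ t : ℝ, t ^ (Module.finrank ℝ E - 1) • (t ^ (2 * j) * Real.exp (-t ^ 2)) =
        t ^ (2 * (n + j) + 1) * Real.exp (-t ^ 2) := fun t => by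
      rw [smul_eq_mul, ← mul_assoc, ← pow_add, finrank_real_of_complex, hn]
      congr 2
      omega
    rw [integral_fun_norm_addHaar μ fun t => t ^ (2 * j) * Real.exp (-t ^ 2)]
    simp only [hpow, integral_Ioi_odd_pow_mul_exp_neg_sq]
  have hzero := hradial 0
  simp only [mul_zero, pow_zero, one_mul, add_zero] at hzero
  rw [hradial, hzero, hn, ← Nat.factorial_mul_ascFactorial]
  simp only [nsmul_eq_mul, smul_eq_mul, Nat.cast_mul]
  ring

/-- The profile `L_p^{(a)}(s) e⁻ˢ` whose radial weight reproduces functions polyanalytic of order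
`p + 1` on a space of complex dimension `a`. -/
def laguerreProfile (a p : ℕ) (s : ℝ) : ℝ := laguerre a p s * Real.exp (-s)

lemma continuous_laguerreProfile (a p : ℕ) : Continuous (laguerreProfile a p) := by
  unfold laguerreProfile laguerre
  fun_prop

lemma pow_mul_laguerreProfile (a p l : ℕ) (r : ℝ) :
    r ^ (2 * l) * laguerreProfile a p (r ^ 2) = ∑ i ∈ Finset.range (p + 1),
      (-1) ^ i * (p + a).choose (p - i) / i.factorial *
        (r ^ (2 * (l + i)) * Real.exp (-r ^ 2)) := by
  rw [laguerreProfile, laguerre, Finset.sum_mul, Finset.mul_sum]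
  refine Finset.sum_congr rfl fun i _ => ?_
  rw [mul_add, pow_add, pow_mul r 2 i]
  ring

lemma integrable_norm_pow_mul_laguerreProfile (a p l : ℕ) :
    Integrable (fun w => ‖w‖ ^ (2 * l) * laguerreProfile a p (‖w‖ ^ 2)) μ := by
  simp only [pow_mul_laguerreProfile]
  exact integrable_finsetSum _ fun i _ => (integrable_norm_pow_mul_exp μ _).const_mul _

lemma integral_norm_pow_mul_laguerreProfile {l p : ℕ} (hl : l ≤ p) :
    ∫ w, ‖w‖ ^ (2 * l) * laguerreProfile (Module.finrank ℂ E) p (‖w‖ ^ 2) ∂μ =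
      (Module.finrank ℂ E).ascFactorial l * (p - l).choose p * ∫ w, Real.exp (-‖w‖ ^ 2) ∂μ := by
  simp only [pow_mul_laguerreProfile]
  rw [integral_finsetSum _ fun i _ => (integrable_norm_pow_mul_exp μ _).const_mul _]
  simp only [integral_const_mul, integral_norm_pow_mul_exp]
  rw [← sum_laguerre_coeff_mul_ascFactorial _ hl, Finset.sum_mul]
  exact Finset.sum_congr rfl fun i _ => (mul_assoc _ _ _).symm

lemma integral_laguerreProfile (p : ℕ) :
    ∫ w, laguerreProfile (Module.finrank ℂ E) p (‖w‖ ^ 2) ∂μ = ∫ w, Real.exp (-‖w‖ ^ 2) ∂μ := by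
  simpa using integral_norm_pow_mul_laguerreProfile μ p.zero_le

lemma isReproducingProfile_laguerreProfile (p : ℕ) :
    IsReproducingProfile μ p (laguerreProfile (Module.finrank ℂ E) p) where
  continuous := continuous_laguerreProfile _ p
  integrable_moment l _ := integrable_norm_pow_mul_laguerreProfile μ _ p l
  moment_eq_zero l hl₁ hl := by
    rw [integral_norm_pow_mul_laguerreProfile μ hl, Nat.choose_eq_zero_of_lt (by omega)]
    simp

end LaguerreMoments

section FockReproduction

variable {E : Type*} [NormedAddCommGroup E] [InnerProductSpace ℂ E] [FiniteDimensional ℂ E]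
  [Nontrivial E] [MeasurableSpace E] [BorelSpace E] (μ : Measure E) [μ.IsAddHaarMeasure]

/-- The substitution `w = u + z` turns the Gaussian kernel into `exp (-‖u‖² - ⟨z, u⟩)`, whose
factor `exp (-⟨z, u⟩)` is holomorphic in `u` and does not raise the order of `f`. -/
theorem PolyanalyticOfOrder.integral_mul_exp_mul_laguerre {p : ℕ} {f : E → ℂ}
    (hf : PolyanalyticOfOrder (p + 1) f) (z : E)
    (hint : Integrable (fun w => f w * Complex.exp (-‖w‖ ^ 2 + inner ℂ w z) *
      laguerre (Module.finrank ℂ E) p (‖w - z‖ ^ 2)) μ) :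
    ∫ w, f w * Complex.exp (-‖w‖ ^ 2 + inner ℂ w z) *
      laguerre (Module.finrank ℂ E) p (‖w - z‖ ^ 2) ∂μ = f z * ∫ w, Real.exp (-‖w‖ ^ 2) ∂μ := by
  have hexponent : ∀ u, -(‖u + z‖ : ℂ) ^ 2 + inner ℂ (u + z) z =
      -(‖u‖ : ℂ) ^ 2 + -inner ℂ z u := fun u => by
    simp only [← inner_self_eq_norm_sq_to_K (𝕜 := ℂ), inner_add_left, inner_add_right,
      ← RCLike.ofReal_eq_complex_ofReal]
    ring
  have hshift : ∀ u, f (u + z) * Complex.exp (-‖u + z‖ ^ 2 + inner ℂ (u + z) z) *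
      laguerre (Module.finrank ℂ E) p (‖u + z - z‖ ^ 2) =
      (Complex.exp (-inner ℂ z u) * f (u + z)) *
        laguerreProfile (Module.finrank ℂ E) p (‖u‖ ^ 2) := fun u => by
    rw [hexponent, Complex.exp_add, add_sub_cancel_right, laguerreProfile]
    push_cast
    ring
  have hexp : ContDiff ℂ ∞ fun u => Complex.exp (-inner ℂ z u) :=
    (innerSL ℂ z).contDiff.neg.cexp
  have hF : PolyanalyticOfOrder (p + 1) fun u => Complex.exp (-inner ℂ z u) * f (u + z) :=
    zero_add p ▸ (of_contDiff_complex hexp 0).mul (hf.comp_affine (.id ℂ E) z)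
  have hintF := hint.comp_add_right z
  simp only [hshift] at hintF
  rw [← integral_add_right_eq_self _ z]
  simp only [hshift]
  rw [(isReproducingProfile_laguerreProfile μ p).integral_mul hF hintF, integral_laguerreProfile]
  simp

end FockReproduction

section CompactProfile

lemma hasCompactSupport_comp_norm_sq {E F : Type*} [NormedAddCommGroup E] [ProperSpace E] [Zero F]
    {χ : ℝ → F} (hχ : HasCompactSupport χ) : HasCompactSupport fun w : E => χ (‖w‖ ^ 2) := by
  rw [hasCompactSupport_iff_eventuallyEq, Filter.coclosedCompact_eq_cocompact] at hχ ⊢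
  have hnorm : Filter.Tendsto (fun w : E => ‖w‖ ^ 2) (Filter.cocompact E) (Filter.cocompact ℝ) :=
    ((Filter.tendsto_pow_atTop two_ne_zero).comp tendsto_norm_cocompact_atTop).mono_right
      atTop_le_cocompact
  exact hnorm.eventually hχ

variable {E : Type*} [NormedAddCommGroup E] [NormedSpace ℝ E] [FiniteDimensional ℝ E]
  [MeasurableSpace E] [BorelSpace E] (μ : Measure E) [μ.IsAddHaarMeasure]

lemma integrable_norm_pow_mul_of_hasCompactSupport {χ : ℝ → ℝ} (hχ : Continuous χ)
    (hsupp : HasCompactSupport χ) (k : ℕ) :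
    Integrable (fun w => ‖w‖ ^ k * χ (‖w‖ ^ 2)) μ :=
  Continuous.integrable_of_hasCompactSupport (by fun_prop)
    (hasCompactSupport_comp_norm_sq hsupp).mul_left

lemma integral_norm_pow_mul_comp_four_mul (χ : ℝ → ℝ) (l : ℕ) :
    ∫ w, ‖w‖ ^ (2 * l) * χ (4 * ‖w‖ ^ 2) ∂μ =
      (2 ^ Module.finrank ℝ E * 4 ^ l)⁻¹ * ∫ w, ‖w‖ ^ (2 * l) * χ (‖w‖ ^ 2) ∂μ := by
  have hscale := Measure.integral_comp_smul μ (fun w => ‖w‖ ^ (2 * l) * χ (‖w‖ ^ 2)) 2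
  have hnorm : ∀ w : E, ‖(2 : ℝ) • w‖ ^ 2 = 4 * ‖w‖ ^ 2 := fun w => by
    rw [norm_smul, Real.norm_two]
    ring
  simp only [pow_mul, hnorm, mul_pow, mul_assoc] at hscale
  rw [integral_const_mul, abs_of_pos (by positivity), smul_eq_mul] at hscale
  simp only [pow_mul]
  rw [mul_inv_rev, mul_assoc, ← hscale, inv_mul_cancel_left₀ (by positivity)]

lemma integral_norm_pow_mul_sub_comp_four_mul {χ : ℝ → ℝ} (hχ : Continuous χ)
    (hsupp : HasCompactSupport χ) (c : ℝ) (l : ℕ) :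
    ∫ w, ‖w‖ ^ (2 * l) * (χ (‖w‖ ^ 2) - c * χ (4 * ‖w‖ ^ 2)) ∂μ =
      (1 - c / (2 ^ Module.finrank ℝ E * 4 ^ l)) * ∫ w, ‖w‖ ^ (2 * l) * χ (‖w‖ ^ 2) ∂μ := by
  have hsupp₄ : HasCompactSupport fun s => χ (4 * s) :=
    hsupp.comp_homeomorph (Homeomorph.mulLeft₀ (4 : ℝ) four_ne_zero)
  have hχ₄ : Continuous fun s => χ (4 * s) := hχ.comp (continuous_const_mul 4)
  simp only [mul_sub, mul_left_comm _ c]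
  rw [integral_sub (integrable_norm_pow_mul_of_hasCompactSupport μ hχ hsupp _)
    ((integrable_norm_pow_mul_of_hasCompactSupport μ hχ₄ hsupp₄ _).const_mul c),
    integral_const_mul, integral_norm_pow_mul_comp_four_mul]
  ring

/-- Subtracting from `χ (‖w‖²)` the multiple of its dilate `χ (4‖w‖²)` that cancels the moment of
order `m + 1` multiplies the other moments by constants. -/
lemma exists_isReproducingProfile_contDiff (m : ℕ) :
    ∃ χ : ℝ → ℝ, ContDiff ℝ ∞ χ ∧ HasCompactSupport χ ∧ IsReproducingProfile μ m χ ∧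
      ∫ w, χ (‖w‖ ^ 2) ∂μ ≠ 0 := by
  induction m with
  | zero =>
    let ρ : ContDiffBump (0 : ℝ) := ⟨1, 2, one_pos, one_lt_two⟩
    have hsupp := hasCompactSupport_comp_norm_sq (E := E) ρ.hasCompactSupport
    have hcont : Continuous fun w : E => ρ (‖w‖ ^ 2) := ρ.continuous.comp (by fun_prop)
    refine ⟨ρ, ρ.contDiff, ρ.hasCompactSupport, ⟨ρ.continuous, fun l _ =>
      integrable_norm_pow_mul_of_hasCompactSupport μ ρ.continuous ρ.hasCompactSupport _,
      fun l hl₁ hl => by omega⟩, ne_of_gt ?_⟩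
    exact hcont.integral_pos_of_hasCompactSupport_nonneg_nonzero hsupp (fun _ => ρ.nonneg)
      (x := 0) (by simp [ρ.one_of_mem_closedBall (x := 0) (by simp [ρ.rIn_pos.le])])
  | succ m ih =>
    obtain ⟨χ, hχ, hsupp, hprofile, hne⟩ := ih
    let c : ℝ := 2 ^ Module.finrank ℝ E * 4 ^ (m + 1)
    have hcontDiff : ContDiff ℝ ∞ fun s => χ s - c * χ (4 * s) :=
      hχ.sub (contDiff_const.mul (hχ.comp (contDiff_const.mul contDiff_id)))
    have hsupport : HasCompactSupport fun s => χ s - c * χ (4 * s) :=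
      hsupp.sub (hsupp.comp_homeomorph (Homeomorph.mulLeft₀ (4 : ℝ) four_ne_zero)).mul_left
    have hmoment := integral_norm_pow_mul_sub_comp_four_mul μ hχ.continuous hsupp c
    refine ⟨_, hcontDiff, hsupport, ⟨hcontDiff.continuous, fun l _ =>
      integrable_norm_pow_mul_of_hasCompactSupport μ hcontDiff.continuous hsupport _,
      fun l hl₁ hl => ?_⟩, ?_⟩
    · rw [hmoment]
      rcases hl.eq_or_lt with rfl | hlt
      · rw [div_self (by positivity), sub_self, zero_mul]
      · rw [hprofile.moment_eq_zero l hl₁ (Nat.lt_succ_iff.1 hlt), mul_zero]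
    · have hzero := hmoment 0
      simp only [mul_zero, pow_zero, one_mul, mul_one] at hzero
      rw [hzero, mul_div_cancel_left₀ _ (by positivity)]
      exact mul_ne_zero (sub_ne_zero.2 (one_lt_pow₀ (by norm_num) m.succ_ne_zero).ne) hne

end CompactProfile

section Convolution

open scoped Convolution
open ContinuousLinearMap (mul)

lemma hasCompactSupport_wirtinger {E : Type*} [NormedAddCommGroup E] [NormedSpace ℂ E] (v : E)
    {ψ : E → ℂ} (hψ : HasCompactSupport ψ) : HasCompactSupport (wirtinger v ψ) :=
  (hψ.fderiv ℝ).comp_left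
    (g := fun A : E →L[ℝ] ℂ => (1 / 2 : ℂ) * (A v + Complex.I * A (Complex.I • v))) (by simp)

variable {E : Type*} [NormedAddCommGroup E] [MeasurableSpace E] [BorelSpace E]

lemma tendstoLocallyUniformly_convolution [ProperSpace E] {μ : Measure E}
    [μ.IsAddHaarMeasure] {ι : Type*} {p : Filter ι} {f : ι → E → ℂ} {F ψ : E → ℂ}
    (hf : ∀ i, Continuous (f i)) (hF : Continuous F) (hψ : Continuous ψ)
    (hψs : HasCompactSupport ψ) (hlim : TendstoLocallyUniformly f F p) :
    TendstoLocallyUniformly (fun i => f i ⋆[mul ℝ ℂ, μ] ψ) (F ⋆[mul ℝ ℂ, μ] ψ) p := by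
  rw [tendstoLocallyUniformly_iff_forall_isCompact] at hlim ⊢
  intro K hK
  have hψint : Integrable ψ μ := hψ.integrable_of_hasCompactSupport hψs
  have hexists : ∀ g : E → ℂ, Continuous g → ∀ z, Integrable (fun t => g t * ψ (z - t)) μ :=
    fun g hg => hψs.convolutionExists_right (mul ℝ ℂ) hg.locallyIntegrable hψ
  set A : ℝ := ∫ t, ‖ψ t‖ ∂μ
  have : 0 ≤ A := integral_nonneg fun _ => norm_nonneg _
  have hK' : IsCompact ((fun p : E × E => p.1 - p.2) '' (K ×ˢ tsupport ψ)) :=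
    (hK.prod hψs).image (by fun_prop)
  rw [Metric.tendstoUniformlyOn_iff]
  intro ε hε
  have hδ : 0 < ε / (A + 1) := by positivity
  filter_upwards [Metric.tendstoUniformlyOn_iff.1 (hlim _ hK') _ hδ] with i hi z hz
  have hbound : ∀ t, ‖F t * ψ (z - t) - f i t * ψ (z - t)‖ ≤ ε / (A + 1) * ‖ψ (z - t)‖ := by
    intro t
    rw [← sub_mul, norm_mul]
    by_cases h0 : ψ (z - t) = 0
    · rw [h0, norm_zero, mul_zero, mul_zero]
    · have hdist := hi t ⟨(z, z - t), ⟨hz, subset_tsupport _ h0⟩, sub_sub_cancel z t⟩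
      rw [dist_eq_norm] at hdist
      gcongr
  calc dist ((F ⋆[mul ℝ ℂ, μ] ψ) z) ((f i ⋆[mul ℝ ℂ, μ] ψ) z)
      = ‖∫ t, (F t * ψ (z - t) - f i t * ψ (z - t)) ∂μ‖ := by
        rw [dist_eq_norm, integral_sub (hexists F hF z) (hexists (f i) (hf i) z)]
        rfl
    _ ≤ ∫ t, ε / (A + 1) * ‖ψ (z - t)‖ ∂μ :=
        norm_integral_le_of_norm_le ((hψint.comp_sub_left z).norm.const_mul _) (.of_forall hbound)
    _ = ε / (A + 1) * A := by
        rw [integral_const_mul, integral_sub_left_eq_self (fun t => ‖ψ t‖)]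
    _ < ε := by
        rw [div_mul_eq_mul_div, div_lt_iff₀ (by positivity)]
        nlinarith

lemma wirtinger_convolution [NormedSpace ℂ E] [FiniteDimensional ℂ E] {μ : Measure E}
    [μ.IsAddHaarMeasure] (v : E) {F ψ : E → ℂ} (hF : LocallyIntegrable F μ)
    (hψ : ContDiff ℝ 1 ψ) (hψs : HasCompactSupport ψ) :
    wirtinger v (F ⋆[mul ℝ ℂ, μ] ψ) = F ⋆[mul ℝ ℂ, μ] wirtinger v ψ := by
  funext z
  have hcont : Continuous (fderiv ℝ ψ) := hψ.continuous_fderiv one_ne_zero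
  have hfderiv : ∀ u, fderiv ℝ (F ⋆[mul ℝ ℂ, μ] ψ) z u = ∫ t, F t * fderiv ℝ ψ (z - t) u ∂μ :=
    fun u => by
      rw [(hψs.hasFDerivAt_convolution_right (mul ℝ ℂ) hF hψ z).fderiv,
        convolution_precompR_apply _ hF (hψs.fderiv ℝ) hcont]
      rfl
  have hint : ∀ u, Integrable (fun t => F t * fderiv ℝ ψ (z - t) u) μ := fun u =>
    ((hψs.fderiv ℝ).comp_left (g := fun A : E →L[ℝ] ℂ => A u) rfl).convolutionExists_right
      (mul ℝ ℂ) hF (hcont.clm_apply continuous_const) z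
  rw [wirtinger, hfderiv, hfderiv, ← integral_const_mul Complex.I,
    ← integral_add (hint _) ((hint _).const_mul _), ← integral_const_mul]
  refine integral_congr_ae (.of_forall fun t => ?_)
  simp only [ContinuousLinearMap.mul_apply', wirtinger]
  ring

end Convolution

section LocallyUniformLimit

open scoped Convolution
open ContinuousLinearMap (mul)

variable {E : Type*} [NormedAddCommGroup E] [InnerProductSpace ℂ E] [FiniteDimensional ℂ E]
  [Nontrivial E]

lemma exists_convolution_eq_self [MeasurableSpace E] [BorelSpace E] (μ : Measure E)
    [μ.IsAddHaarMeasure] (m : ℕ) :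
    ∃ ψ : E → ℂ, ContDiff ℝ ∞ ψ ∧ HasCompactSupport ψ ∧
      ∀ F, PolyanalyticOfOrder (m + 1) F → F ⋆[mul ℝ ℂ, μ] ψ = F := by
  let _ : InnerProductSpace ℝ E := InnerProductSpace.rclikeToReal ℂ E
  obtain ⟨χ, hχ, hχs, hprofile, hc⟩ := exists_isReproducingProfile_contDiff μ m
  set c : ℝ := ∫ w, χ (‖w‖ ^ 2) ∂μ
  let φ : E → ℂ := fun w => (χ (‖w‖ ^ 2) : ℂ)
  have hφ : ContDiff ℝ ∞ φ :=
    Complex.ofRealCLM.contDiff.comp (hχ.comp (contDiff_id.norm_sq ℝ))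
  have hφs : HasCompactSupport φ := (hasCompactSupport_comp_norm_sq hχs).comp_left
    (g := ((↑) : ℝ → ℂ)) Complex.ofReal_zero
  refine ⟨fun w => (c : ℂ)⁻¹ * φ w, contDiff_const.mul hφ, hφs.mul_left, fun F hF => ?_⟩
  funext z
  have hF' : PolyanalyticOfOrder (m + 1) fun w => F (w + z) := hF.comp_affine (.id ℂ E) z
  have hint : Integrable (fun w => F (w + z) * φ w) μ :=
    (hF'.contDiff.continuous.mul hφ.continuous).integrable_of_hasCompactSupport hφs.mul_left
  have hmean : ∫ w, F (w + z) * φ w ∂μ = F z * c := by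
    simpa only [zero_add] using hprofile.integral_mul hF' hint
  calc (F ⋆[mul ℝ ℂ, μ] fun w => (c : ℂ)⁻¹ * φ w) z
      = ∫ w, F (w + z) * ((c : ℂ)⁻¹ * φ (z - (w + z))) ∂μ :=
        (integral_add_right_eq_self (fun t => F t * ((c : ℂ)⁻¹ * φ (z - t))) z).symm
    _ = (c : ℂ)⁻¹ * ∫ w, F (w + z) * φ w ∂μ := by
        rw [← integral_const_mul]
        refine integral_congr_ae (.of_forall fun w => ?_)
        simp only [φ, sub_add_cancel_right, norm_neg]
        ring
    _ = F z := by
        rw [hmean, mul_comm, mul_inv_cancel_right₀ (Complex.ofReal_ne_zero.2 hc)]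

/-- A limit equals its convolution with a smooth reproducing bump, and the derivatives may be moved
onto the bump. -/
theorem PolyanalyticOfOrder.of_tendstoLocallyUniformly {ι : Type*} {p : Filter ι} [p.NeBot] {m : ℕ}
    {f : ι → E → ℂ} {F : E → ℂ} (hf : ∀ i, PolyanalyticOfOrder m (f i))
    (hlim : TendstoLocallyUniformly f F p) : PolyanalyticOfOrder m F := by
  borelize E
  induction m generalizing f F with
  | zero =>
    obtain rfl : f = fun _ => 0 := funext hf
    exact funext fun z => tendsto_nhds_unique
      (hlim.tendstoLocallyUniformlyOn.tendsto_at (Set.mem_univ z)) tendsto_const_nhds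
  | succ m ih =>
    have hcont : ∀ i, Continuous (f i) := fun i => (hf i).contDiff.continuous
    have hF : Continuous F := hlim.continuous (.of_forall hcont)
    let μ : Measure E := Measure.addHaar
    obtain ⟨ψ, hψ, hψs, hrep⟩ := exists_convolution_eq_self μ m
    have hFψ : F ⋆[ContinuousLinearMap.mul ℝ ℂ, μ] ψ = F := by
      have hconv := tendstoLocallyUniformly_convolution (μ := μ) hcont hF hψ.continuous hψs hlim
      simp only [fun i => hrep (f i) (hf i)] at hconv
      exact funext fun z => tendsto_nhds_unique
        (hconv.tendstoLocallyUniformlyOn.tendsto_at (Set.mem_univ z))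
        (hlim.tendstoLocallyUniformlyOn.tendsto_at (Set.mem_univ z))
    have hdbar : ∀ v {g}, Continuous g → g ⋆[ContinuousLinearMap.mul ℝ ℂ, μ] ψ = g →
        g ⋆[ContinuousLinearMap.mul ℝ ℂ, μ] wirtinger v ψ = wirtinger v g := fun v g hg hgψ => by
      rw [← wirtinger_convolution v hg.locallyIntegrable (hψ.of_le (by simp)) hψs, hgψ]
    have hFsmooth : ContDiff ℝ ∞ F := by
      rw [← hFψ]
      exact hψs.contDiff_convolution_right _ hF.locallyIntegrable hψ
    refine ⟨hFsmooth, fun v => ih (fun i => (hf i).2 v) ?_⟩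
    have hconv := tendstoLocallyUniformly_convolution (μ := μ) hcont hF
      (contDiff_wirtinger v hψ).continuous (hasCompactSupport_wirtinger v hψs) hlim
    simpa only [hdbar v hF hFψ, fun i => hdbar v (hcont i) (hrep _ (hf i))] using hconv

end LocallyUniformLimit

section FlatGeometry

variable {n : ℕ}

/-- The identification `(x, y) ↦ x + i y` of `ℝ²ⁿ` with `ℂⁿ`. The target carries the Euclidean
norm, so that the results about complex inner product spaces apply. -/
def complexPoint (n : ℕ) : R2 n ≃L[ℝ] EuclideanSpace ℂ (Fin n) :=
  LinearEquiv.toContinuousLinearEquiv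
    { toFun := fun p => WithLp.toLp 2 (toCn n 1 p)
      invFun := fun z => (WithLp.toLp 2 fun r => (z r).re, WithLp.toLp 2 fun r => (z r).im)
      map_add' := fun p q => by
        ext r
        simp only [toCn, Prod.fst_add, Prod.snd_add, PiLp.add_apply, Complex.ofReal_add,
          Real.sqrt_one, Complex.ofReal_one, div_one]
        ring
      map_smul' := fun c p => by
        ext r
        simp only [toCn, Prod.smul_fst, Prod.smul_snd, PiLp.smul_apply, smul_eq_mul,
          Complex.ofReal_mul, Real.sqrt_one, Complex.ofReal_one, div_one, RingHom.id_apply,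
          Complex.real_smul]
        ring
      left_inv := fun p => by ext r <;> simp [toCn]
      right_inv := fun z => by
        ext r
        simp [toCn, mul_comm Complex.I] }

lemma complexPoint_apply (p : R2 n) (r : Fin n) :
    complexPoint n p r = p.1 r + Complex.I * p.2 r := by
  change toCn n 1 p r = _
  rw [toCn, Real.sqrt_one, Complex.ofReal_one, div_one]

lemma toCn_eq_smul_complexPoint (α : ℝ) (p : R2 n) :
    toCn n α p = (Real.sqrt α : ℂ)⁻¹ • (complexPoint n p).ofLp := by
  funext r
  rw [Pi.smul_apply, complexPoint_apply, toCn, smul_eq_mul, div_eq_inv_mul]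

lemma inner_complexPoint (p q : R2 n) : inner ℂ (complexPoint n p) (complexPoint n q) =
    ((inner ℝ p.1 q.1 + inner ℝ p.2 q.2 : ℝ) : ℂ) +
      Complex.I * ((inner ℝ p.1 q.2 - inner ℝ p.2 q.1 : ℝ) : ℂ) := by
  simp only [PiLp.inner_apply, ← Finset.sum_add_distrib, ← Finset.sum_sub_distrib,
    Complex.ofReal_sum, Finset.mul_sum, complexPoint_apply]
  refine Finset.sum_congr rfl fun r _ => ?_
  apply Complex.ext
  · simp
  · simp
    ring

lemma norm_complexPoint_sq (p : R2 n) : ‖complexPoint n p‖ ^ 2 = ‖p.1‖ ^ 2 + ‖p.2‖ ^ 2 := by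
  rw [← real_inner_self_eq_norm_sq p.1, ← real_inner_self_eq_norm_sq p.2,
    ← Complex.ofReal_inj, Complex.ofReal_pow, ← RCLike.ofReal_eq_complex_ofReal,
    ← inner_self_eq_norm_sq_to_K, inner_complexPoint,
    real_inner_comm p.1 p.2, sub_self]
  simp

lemma norm_complexPoint_sub_sq (p q : R2 n) :
    ‖complexPoint n q - complexPoint n p‖ ^ 2 = ‖q.1 - p.1‖ ^ 2 + ‖q.2 - p.2‖ ^ 2 := by
  rw [← map_sub, norm_complexPoint_sq, Prod.fst_sub, Prod.snd_sub]

/-- The exponent of the weight in the flattening operator. -/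
def flatExponent (p : R2 n) : ℂ :=
  -(1 / 2) * (‖p.1‖ ^ 2 : ℝ) - (1 / 2) * (‖p.2‖ ^ 2 : ℝ) - Complex.I * (inner ℝ p.1 p.2 : ℝ)

/-- The exponent of the reproducing kernel. -/
def kernelExponent (p q : R2 n) : ℂ :=
  -(1 / 2) * ((‖q.1 - p.1‖ ^ 2 + ‖q.2 - p.2‖ ^ 2 : ℝ) : ℂ) -
    Complex.I * (inner ℝ (q.1 - p.1) (q.2 + p.2) : ℝ)

lemma continuous_flatExponent : Continuous (flatExponent (n := n)) := by
  unfold flatExponent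
  fun_prop

lemma conj_flatExponent (p : R2 n) :
    (starRingEnd ℂ) (flatExponent p) = -(‖complexPoint n p‖ : ℂ) ^ 2 - flatExponent p := by
  rw [← Complex.ofReal_pow, norm_complexPoint_sq]
  apply Complex.ext <;> simp [flatExponent] <;> ring

lemma re_flatExponent (p : R2 n) : (flatExponent p).re = -(‖complexPoint n p‖ ^ 2 / 2) := by
  rw [norm_complexPoint_sq]
  simp [flatExponent, -Complex.ofReal_pow]
  ring

lemma re_kernelExponent (p q : R2 n) :
    (kernelExponent p q).re = -(‖complexPoint n q - complexPoint n p‖ ^ 2 / 2) := by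
  rw [norm_complexPoint_sub_sq]
  simp [kernelExponent, -Complex.ofReal_pow, -Complex.ofReal_add]
  ring

lemma kernelExponent_eq (p q : R2 n) : kernelExponent p q =
    flatExponent q + (starRingEnd ℂ) (flatExponent p) +
      inner ℂ (complexPoint n p) (complexPoint n q) := by
  rw [inner_complexPoint, kernelExponent, norm_sub_sq_real, norm_sub_sq_real, inner_sub_left,
    inner_add_right, inner_add_right, real_inner_comm p.1 q.1, real_inner_comm p.2 q.2,
    real_inner_comm q.1 p.2]
  apply Complex.ext <;> simp [flatExponent] <;> ring

end FlatGeometry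

section FlatMembership

variable {n m : ℕ} {α : ℝ}

lemma flatten_apply (f : (Fin n → ℂ) → ℂ) (p : R2 n) : flatten n α f p =
    (((2 : ℝ) ^ ((n : ℝ) / 2) : ℝ) : ℂ) * Complex.exp (flatExponent p) * f (toCn n α p) := rfl

lemma norm_flatten_sq (f : (Fin n → ℂ) → ℂ) (p : R2 n) :
    ‖flatten n α f p‖ ^ 2 = 2 ^ n * Real.exp (-∑ r, ‖toCn n 1 p r‖ ^ 2) *
      ‖f ((Real.sqrt α)⁻¹ • toCn n 1 p)‖ ^ 2 := by
  have hpow : ((2 : ℝ) ^ ((n : ℝ) / 2)) ^ 2 = 2 ^ n := by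
    rw [← Real.rpow_natCast, ← Real.rpow_mul two_pos.le, Nat.cast_ofNat,
      div_mul_cancel₀ _ two_ne_zero, Real.rpow_natCast]
  have hexp : Real.exp (flatExponent p).re ^ 2 = Real.exp (-∑ r, ‖toCn n 1 p r‖ ^ 2) := by
    rw [← Real.exp_nat_mul, re_flatExponent, EuclideanSpace.norm_sq_eq]
    congr 1
    push_cast
    change 2 * -((∑ r, ‖toCn n 1 p r‖ ^ 2) / 2) = _
    ring
  have hpoint : toCn n α p = (Real.sqrt α)⁻¹ • toCn n 1 p := by
    rw [toCn_eq_smul_complexPoint, ← Complex.ofReal_inv, Complex.coe_smul]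
    rfl
  rw [flatten_apply, norm_mul, norm_mul, Complex.norm_exp, mul_pow, mul_pow, Complex.norm_real,
    Real.norm_eq_abs, sq_abs, hpow, hexp, hpoint]

lemma memLp_gaussMeasure_of_memLp_flatten (hα : 0 < α) {f : (Fin n → ℂ) → ℂ} (hf : Continuous f)
    (h : MemLp (flatten n α f) 2 (flatMeasure n)) : MemLp f 2 (gaussMeasure n α) := by
  have hpi := Real.pi_pos
  have hsqrt := Real.sqrt_pos.2 hα
  rw [memLp_two_iff_integrable_sq_norm h.1, flatMeasure, integrable_smul_measure
    (by simp only [ne_eq, ENNReal.ofReal_eq_zero, not_le]; positivity) ENNReal.ofReal_ne_top] at h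
  simp only [norm_flatten_sq] at h
  rw [memLp_two_iff_integrable_sq_norm hf.aestronglyMeasurable, gaussMeasure,
    integrable_withDensity_iff (by fun_prop) (by simp)]
  have hflat : Integrable fun w : Fin n → ℂ => 2 ^ n * Real.exp (-∑ r, ‖w r‖ ^ 2) *
      ‖f ((Real.sqrt α)⁻¹ • w)‖ ^ 2 :=
    ((measurePreserving_toCn_one n).integrable_comp
      (Continuous.aestronglyMeasurable (by fun_prop))).1 h
  refine ((hflat.comp_smul (R := Real.sqrt α) hsqrt.ne').const_mul
    ((α / Real.pi) ^ n * (2 ^ n)⁻¹)).congr (ae_of_all _ fun w => ?_)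
  have hscale : ∑ r, ‖(Real.sqrt α • w) r‖ ^ 2 = α * ∑ r, ‖w r‖ ^ 2 := by
    simp only [Pi.smul_apply, norm_smul, mul_pow, Real.norm_eq_abs, sq_abs, Real.sq_sqrt hα.le,
      Finset.mul_sum]
  simp only [hscale, inv_smul_smul₀ hsqrt.ne']
  rw [ENNReal.toReal_ofReal (by positivity), neg_mul]
  field_simp

/-- The function on `ℂⁿ` obtained from a function on `ℝ²ⁿ` by dividing out the weight of the
flattening operator. For `g` in the image of that operator it is polyanalytic. -/
def unweight (g : R2 n → ℂ) (z : EuclideanSpace ℂ (Fin n)) : ℂ :=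
  Complex.exp (-flatExponent ((complexPoint n).symm z)) * g ((complexPoint n).symm z)

lemma exp_mul_unweight (g : R2 n → ℂ) (p : R2 n) :
    Complex.exp (flatExponent p) * unweight g (complexPoint n p) = g p := by
  rw [unweight, ContinuousLinearEquiv.symm_apply_apply, ← mul_assoc, ← Complex.exp_add,
    add_neg_cancel, Complex.exp_zero, one_mul]

lemma unweight_flatten (f : (Fin n → ℂ) → ℂ) (z : EuclideanSpace ℂ (Fin n)) :
    unweight (flatten n α f) z =
      (((2 : ℝ) ^ ((n : ℝ) / 2) : ℝ) : ℂ) * f ((Real.sqrt α : ℂ)⁻¹ • z.ofLp) := by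
  rw [unweight, flatten_apply, toCn_eq_smul_complexPoint,
    ContinuousLinearEquiv.apply_symm_apply, Complex.exp_neg]
  field_simp [Complex.exp_ne_zero]

lemma surjective_flatten (hα : 0 < α) : Function.Surjective (flatten n α) := by
  intro g
  have hsqrt : (Real.sqrt α : ℂ) ≠ 0 := Complex.ofReal_ne_zero.2 (Real.sqrt_pos.2 hα).ne'
  have hc : (((2 : ℝ) ^ ((n : ℝ) / 2) : ℝ) : ℂ) ≠ 0 :=
    Complex.ofReal_ne_zero.2 (Real.rpow_pos_of_pos two_pos _).ne'
  refine ⟨fun w => (((2 : ℝ) ^ ((n : ℝ) / 2) : ℝ) : ℂ)⁻¹ *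
    unweight g (WithLp.toLp 2 ((Real.sqrt α : ℂ) • w)), funext fun p => ?_⟩
  rw [flatten_apply, toCn_eq_smul_complexPoint, smul_inv_smul₀ hsqrt, WithLp.toLp_ofLp,
    mul_right_comm, mul_inv_cancel_left₀ hc, mul_comm, exp_mul_unweight]

lemma polyanalyticOfOrder_unweight_flatten_iff (hα : 0 < α) {f : (Fin n → ℂ) → ℂ} :
    PolyanalyticOfOrder m (unweight (flatten n α f)) ↔ PolyanalyticOfOrder m f := by
  set e : EuclideanSpace ℂ (Fin n) ≃L[ℂ] (Fin n → ℂ) := EuclideanSpace.equiv (Fin n) ℂ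
  set c : ℂ := (((2 : ℝ) ^ ((n : ℝ) / 2) : ℝ) : ℂ)
  set s : ℂ := (Real.sqrt α : ℂ)
  have hs : s ≠ 0 := Complex.ofReal_ne_zero.2 (Real.sqrt_pos.2 hα).ne'
  have hc : c ≠ 0 := Complex.ofReal_ne_zero.2 (Real.rpow_pos_of_pos two_pos _).ne'
  have hunweight : unweight (flatten n α f) = fun z => c * f (s⁻¹ • e z) :=
    funext (unweight_flatten f)
  rw [hunweight]
  constructor <;> intro h
  · have hcomp := (h.comp_affine (s • e.symm.toContinuousLinearMap) 0).const_mul c⁻¹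
    convert! hcomp using 1
    funext w
    simp [hs, hc]
  · have hcomp := (h.comp_affine (s⁻¹ • e.toContinuousLinearMap) 0).const_mul c
    convert! hcomp using 1
    funext w
    simp

lemma mem_flatSubmodule_iff (hα : 0 < α) {g : R2 n → ℂ} : g ∈ flatSubmodule n m α ↔
    PolyanalyticOfOrder m (unweight g) ∧ MemLp g 2 (flatMeasure n) := by
  constructor
  · refine fun hg => ⟨?_, memLp_of_mem hα hg⟩
    obtain ⟨f, ⟨hf, -⟩, rfl⟩ := hg
    rwa [polyanalyticOfOrder_unweight_flatten_iff hα, ← isPolyanalytic_iff_polyanalyticOfOrder]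
  · rintro ⟨hg, hgL2⟩
    obtain ⟨f, rfl⟩ := surjective_flatten hα g
    rw [polyanalyticOfOrder_unweight_flatten_iff hα] at hg
    exact ⟨f, ⟨isPolyanalytic_iff_polyanalyticOfOrder.2 hg,
      memLp_gaussMeasure_of_memLp_flatten hα hg.contDiff.continuous hgL2⟩, rfl⟩

end FlatMembership

section FlatKernel

variable {n m : ℕ} {α : ℝ}

instance : (flatMeasure n).IsAddHaarMeasure :=
  have : (volume : Measure (R2 n)).IsAddHaarMeasure := Measure.prod.instIsAddHaarMeasure _ _
  Measure.IsAddHaarMeasure.smul _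
    (ENNReal.ofReal_pos.2 (inv_pos.2 (pow_pos Real.two_pi_pos n))).ne' ENNReal.ofReal_ne_top

instance : ((flatMeasure n).map (complexPoint n)).IsAddHaarMeasure :=
  (complexPoint n).isAddHaarMeasure_map _

lemma integral_exp_neg_norm_complexPoint_sq :
    ∫ p, Real.exp (-‖complexPoint n p‖ ^ 2) ∂(flatMeasure n) = (2 ^ n)⁻¹ := by
  have hpi := Real.pi_pos
  have hgauss : ∫ x : EuclideanSpace ℝ (Fin n), Real.exp (-‖x‖ ^ 2) = Real.sqrt (Real.pi ^ n) := by
    have h := GaussianFourier.integral_rexp_neg_mul_sq_norm (V := EuclideanSpace ℝ (Fin n)) one_pos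
    simp only [neg_mul, one_mul, div_one, finrank_euclideanSpace_fin] at h
    rw [h, Real.sqrt_eq_rpow, ← Real.rpow_natCast, ← Real.rpow_mul hpi.le]
    ring_nf
  have hfactor : ∀ p : R2 n, Real.exp (-‖complexPoint n p‖ ^ 2) =
      Real.exp (-‖p.1‖ ^ 2) * Real.exp (-‖p.2‖ ^ 2) := fun p => by
    rw [norm_complexPoint_sq, neg_add, Real.exp_add]
  rw [flatMeasure, integral_smul_measure, ENNReal.toReal_ofReal (by positivity)]
  simp only [hfactor]
  rw [Measure.volume_eq_prod, integral_prod_mul (fun x => Real.exp (-‖x‖ ^ 2))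
    fun y => Real.exp (-‖y‖ ^ 2), hgauss, Real.mul_self_sqrt (by positivity), smul_eq_mul, mul_pow]
  field_simp

lemma memLp_laguerre_norm_sq_mul_exp {E : Type*} [NormedAddCommGroup E] [NormedSpace ℝ E]
    [Nontrivial E] [FiniteDimensional ℝ E] [MeasurableSpace E] [BorelSpace E] (μ : Measure E)
    [μ.IsAddHaarMeasure] (a p : ℕ) :
    MemLp (fun w => laguerre a p (‖w‖ ^ 2) * Real.exp (-(‖w‖ ^ 2 / 2))) 2 μ := by
  have hmonomial : ∀ i : ℕ, MemLp (fun w : E => (‖w‖ ^ 2) ^ i * Real.exp (-(‖w‖ ^ 2 / 2))) 2 μ := by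
    intro i
    rw [memLp_two_iff_integrable_sq (Continuous.aestronglyMeasurable (by fun_prop))]
    refine (integrable_norm_pow_mul_exp μ (4 * i)).congr (ae_of_all _ fun w => ?_)
    dsimp only
    rw [mul_pow, ← pow_mul, ← pow_mul, ← Real.exp_nat_mul]
    ring_nf
  simp only [laguerre, Finset.sum_mul, mul_div_right_comm _ ((‖_‖ ^ 2) ^ _), mul_assoc _ (_ ^ _)]
  exact memLp_finsetSum _ fun i _ => (hmonomial i).const_mul _

/-- The reproducing kernel of the flattened space of `(d + 1)`-analytic functions. -/
def flatKernel (n d : ℕ) (p q : R2 n) : ℂ :=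
  2 ^ n * Complex.exp (kernelExponent p q) *
    (laguerre n d (‖q.1 - p.1‖ ^ 2 + ‖q.2 - p.2‖ ^ 2) : ℂ)

lemma norm_flatKernel (d : ℕ) (p q : R2 n) : ‖flatKernel n d p q‖ =
    ‖2 ^ n * (laguerre n d (‖complexPoint n q - complexPoint n p‖ ^ 2) *
      Real.exp (-(‖complexPoint n q - complexPoint n p‖ ^ 2 / 2)))‖ := by
  rw [flatKernel, norm_mul, norm_mul, Complex.norm_exp, re_kernelExponent,
    ← norm_complexPoint_sub_sq, Complex.norm_real, norm_mul, norm_mul, norm_pow, norm_pow,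
    Real.norm_of_nonneg (Real.exp_pos _).le, Complex.norm_ofNat, Real.norm_ofNat]
  ring

lemma continuous_flatKernel (d : ℕ) (p : R2 n) : Continuous (flatKernel n d p) := by
  unfold flatKernel kernelExponent laguerre
  fun_prop

lemma memLp_flatKernel (hn : 1 ≤ n) (d : ℕ) (p : R2 n) :
    MemLp (flatKernel n d p) 2 (flatMeasure n) := by
  have : NeZero n := ⟨by omega⟩
  have hpreserving := (measurePreserving_sub_right ((flatMeasure n).map (complexPoint n))
    (complexPoint n p)).comp
      ((complexPoint n).continuous.measurable.measurePreserving (flatMeasure n))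
  refine (((memLp_laguerre_norm_sq_mul_exp _ n d).const_mul (2 ^ n)).comp_measurePreserving
    hpreserving).congr_norm (continuous_flatKernel d p).aestronglyMeasurable
    (ae_of_all _ fun q => (norm_flatKernel d p q).symm)

lemma unweight_flatKernel (d : ℕ) (p : R2 n) (z : EuclideanSpace ℂ (Fin n)) :
    unweight (flatKernel n d p) z = 2 ^ n * Complex.exp (starRingEnd ℂ (flatExponent p)) *
      (Complex.exp (inner ℂ (complexPoint n p) z) *
        (laguerre n d (‖z - complexPoint n p‖ ^ 2) : ℂ)) := by
  obtain ⟨q, rfl⟩ := (complexPoint n).surjective z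
  rw [unweight, ContinuousLinearEquiv.symm_apply_apply, flatKernel, kernelExponent_eq,
    norm_complexPoint_sub_sq, Complex.exp_add, Complex.exp_add, Complex.exp_neg]
  field_simp [Complex.exp_ne_zero]

lemma flatKernel_mem (hn : 1 ≤ n) (d : ℕ) (hα : 0 < α) (p : R2 n) :
    flatKernel n d p ∈ flatSubmodule n (d + 1) α := by
  refine (mem_flatSubmodule_iff hα).2 ⟨?_, memLp_flatKernel hn d p⟩
  have hexp : ContDiff ℂ ∞ fun z => Complex.exp (inner ℂ (complexPoint n p) z) :=
    (innerSL ℂ (complexPoint n p)).contDiff.cexp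
  rw [funext (unweight_flatKernel d p)]
  exact (zero_add d ▸ (PolyanalyticOfOrder.of_contDiff_complex hexp 0).mul
    (PolyanalyticOfOrder.laguerre_norm_sub_sq n d (complexPoint n p))).const_mul _

lemma star_flatKernel_mul (d : ℕ) (g : R2 n → ℂ) (p q : R2 n) :
    star (flatKernel n d p q) * g q = 2 ^ n * Complex.exp (flatExponent p) *
      (unweight g (complexPoint n q) *
        Complex.exp (-‖complexPoint n q‖ ^ 2 + inner ℂ (complexPoint n q) (complexPoint n p)) *
          laguerre n d (‖complexPoint n q - complexPoint n p‖ ^ 2)) := by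
  rw [← exp_mul_unweight g q, flatKernel, kernelExponent_eq, ← norm_complexPoint_sub_sq,
    Complex.star_def, map_mul, map_mul, map_pow, Complex.conj_ofReal, Complex.conj_ofNat,
    ← Complex.exp_conj, map_add, map_add, Complex.conj_conj, inner_conj_symm, conj_flatExponent,
    Complex.exp_add, Complex.exp_add, Complex.exp_add, Complex.exp_sub]
  field_simp [Complex.exp_ne_zero]

theorem integral_star_flatKernel_mul (hn : 1 ≤ n) {d : ℕ} (hα : 0 < α) {g : R2 n → ℂ}
    (hg : g ∈ flatSubmodule n (d + 1) α) (p : R2 n) :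
    ∫ q, star (flatKernel n d p q) * g q ∂(flatMeasure n) = g p := by
  have : NeZero n := ⟨by omega⟩
  obtain ⟨hpoly, hgL2⟩ := (mem_flatSubmodule_iff hα).1 hg
  have hemb : MeasurableEmbedding (complexPoint n) :=
    (complexPoint n).toHomeomorph.measurableEmbedding
  have hc : (2 ^ n * Complex.exp (flatExponent p) : ℂ) ≠ 0 := by simp [Complex.exp_ne_zero]
  have hint : Integrable (fun q => star (flatKernel n d p q) * g q) (flatMeasure n) :=
    (memLp_flatKernel hn d p).star.integrable_mul hgL2
  simp only [star_flatKernel_mul] at hint ⊢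
  have hrep := hpoly.integral_mul_exp_mul_laguerre ((flatMeasure n).map (complexPoint n))
    (complexPoint n p)
  rw [finrank_euclideanSpace_fin] at hrep
  have hrep := hrep (hemb.integrable_map_iff.2 ((integrable_const_mul_iff hc.isUnit _).1 hint))
  rw [hemb.integral_map, hemb.integral_map, integral_exp_neg_norm_complexPoint_sq] at hrep
  rw [integral_const_mul, hrep, ← exp_mul_unweight g p]
  push_cast
  field_simp

end FlatKernel

section FlatCompleteness

variable {n m d : ℕ} {α : ℝ} {hα : 0 < α}

lemma FlatSpace.inner_eq_integral (g h : FlatSpace n m α hα) :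
    inner ℂ g h = ∫ q, star (g.toFun q) * h.toFun q ∂(flatMeasure n) := by
  change inner ℂ (toL2 g) (toL2 h) = _
  rw [L2.inner_def]
  refine integral_congr_ae ?_
  filter_upwards [(memLp_of_mem hα g.2).coeFn_toLp, (memLp_of_mem hα h.2).coeFn_toLp] with q hg hh
  change inner ℂ ((memLp_of_mem hα g.2).toLp g.1 q) ((memLp_of_mem hα h.2).toLp h.1 q) = _
  rw [hg, hh, RCLike.inner_apply, mul_comm]
  rfl

/-- The reproducing kernel at `p`, as an element of the flattened space. -/
def FlatSpace.kernelAt (hn : 1 ≤ n) (d : ℕ) (hα : 0 < α) (p : R2 n) : FlatSpace n (d + 1) α hα :=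
  ⟨flatKernel n d p, flatKernel_mem hn d hα p⟩

lemma FlatSpace.inner_kernelAt (hn : 1 ≤ n) (g : FlatSpace n (d + 1) α hα) (p : R2 n) :
    inner ℂ (kernelAt hn d hα p) g = g.toFun p := by
  rw [inner_eq_integral]
  exact integral_star_flatKernel_mul hn hα g.2 p

lemma laguerre_zero_right (a p : ℕ) : laguerre a p 0 = (p + a).choose p := by
  rw [laguerre, Finset.sum_range_succ']
  simp

lemma flatKernel_self (n d : ℕ) (p : R2 n) :
    flatKernel n d p p = ((2 ^ n * ((d + n).choose d : ℝ) : ℝ) : ℂ) := by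
  simp [flatKernel, kernelExponent, laguerre_zero_right]

lemma FlatSpace.norm_kernelAt (hn : 1 ≤ n) (p : R2 n) :
    ‖kernelAt hn d hα p‖ = Real.sqrt (2 ^ n * (d + n).choose d) := by
  have hsq : ‖kernelAt hn d hα p‖ ^ 2 = 2 ^ n * (d + n).choose d := by
    rw [norm_sq_eq_re_inner (𝕜 := ℂ), inner_kernelAt]
    change (flatKernel n d p p).re = _
    rw [flatKernel_self, Complex.ofReal_re]
  rw [← hsq, Real.sqrt_sq (norm_nonneg _)]

lemma FlatSpace.dist_toFun_le (hn : 1 ≤ n) (g h : FlatSpace n (d + 1) α hα) (p : R2 n) :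
    dist (g.toFun p) (h.toFun p) ≤ Real.sqrt (2 ^ n * (d + n).choose d) * dist g h := by
  rw [dist_eq_norm, dist_eq_norm, ← inner_kernelAt hn, ← inner_kernelAt hn, ← inner_sub_right,
    ← norm_kernelAt hn p]
  exact norm_inner_le_norm _ _

lemma FlatSpace.isometry_toL2 :
    Isometry (toL2 : FlatSpace n m α hα →ₗ[ℂ] Lp ℂ 2 (flatMeasure n)) :=
  AddMonoidHomClass.isometry_of_norm _ fun _ => rfl

lemma mem_flatSubmodule_of_tendstoUniformly (hn : 1 ≤ n) (hα : 0 < α) {ι : Type*} {l : Filter ι}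
    [l.NeBot] {g : ι → R2 n → ℂ} {G : R2 n → ℂ} (hg : ∀ i, g i ∈ flatSubmodule n m α)
    (hG : MemLp G 2 (flatMeasure n)) (hlim : TendstoUniformly g G l) :
    G ∈ flatSubmodule n m α := by
  have : NeZero n := ⟨by omega⟩
  have hG_cont : Continuous G := hlim.continuous (.of_forall fun i => continuous_of_mem (hg i))
  have hweight : Continuous fun z => Complex.exp (-flatExponent ((complexPoint n).symm z)) :=
    (continuous_flatExponent.comp (complexPoint n).symm.continuous).neg.cexp
  have hconst : TendstoUniformly (fun (_ : ι) z => Complex.exp (-flatExponent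
      ((complexPoint n).symm z))) (fun z => Complex.exp (-flatExponent ((complexPoint n).symm z)))
      l := fun _ hu => .of_forall fun _ _ => refl_mem_uniformity hu
  have hunweight : TendstoLocallyUniformly (fun i => unweight (g i)) (unweight G) l :=
    hconst.tendstoLocallyUniformly.mul₀ (hlim.comp (complexPoint n).symm).tendstoLocallyUniformly
      hweight (hG_cont.comp (complexPoint n).symm.continuous)
  exact (mem_flatSubmodule_iff hα).2
    ⟨.of_tendstoLocallyUniformly (fun i => ((mem_flatSubmodule_iff hα).1 (hg i)).1) hunweight, hG⟩

lemma FlatSpace.exists_tendstoUniformly (hn : 1 ≤ n) {g : ℕ → FlatSpace n (d + 1) α hα}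
    (hg : CauchySeq g) : ∃ G, TendstoUniformly (fun k => (g k).toFun) G Filter.atTop := by
  have hlipschitz := UniformFun.lipschitzWith_ofFun_iff.2 fun p =>
    LipschitzWith.of_dist_le' fun g h : FlatSpace n (d + 1) α hα => dist_toFun_le hn g h p
  obtain ⟨G, hG⟩ := cauchySeq_tendsto_of_complete
    (hlipschitz.uniformContinuous.comp_cauchySeq hg)
  exact ⟨_, UniformFun.tendsto_iff_tendstoUniformly.1 hG⟩

theorem FlatSpace.completeSpace (hn : 1 ≤ n) (d : ℕ) (hα : 0 < α) :
    CompleteSpace (FlatSpace n (d + 1) α hα) := by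
  refine Metric.complete_of_cauchySeq_tendsto fun g hg => ?_
  obtain ⟨G, hG⟩ := exists_tendstoUniformly hn hg
  obtain ⟨h, hh⟩ := cauchySeq_tendsto_of_complete
    (isometry_toL2.uniformContinuous.comp_cauchySeq hg)
  have hae : h =ᵐ[flatMeasure n] G := by
    obtain ⟨ns, hns, hlim⟩ := (tendstoInMeasure_of_tendsto_Lp hh).exists_seq_tendsto_ae
    have hcoe : ∀ᵐ p ∂(flatMeasure n), ∀ k, toL2 (g k) p = (g k).toFun p :=
      ae_all_iff.2 fun k => (memLp_of_mem hα (g k).2).coeFn_toLp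
    filter_upwards [hlim, hcoe] with p hsub hcoe
    simp only [Function.comp_apply, hcoe] at hsub
    exact tendsto_nhds_unique hsub ((hG.tendsto_at p).comp hns.tendsto_atTop)
  have hGmem : MemLp G 2 (flatMeasure n) := (memLp_congr_ae hae).1 (Lp.memLp h)
  let G' : FlatSpace n (d + 1) α hα :=
    ⟨G, mem_flatSubmodule_of_tendstoUniformly hn hα (fun k => (g k).2) hGmem hG⟩
  have hG' : toL2 G' = h := Lp.ext ((memLp_of_mem hα G'.2).coeFn_toLp.trans hae.symm)
  refine ⟨G', isometry_toL2.isEmbedding.tendsto_nhds_iff.2 ?_⟩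
  rw [hG']
  exact hh

end FlatCompleteness

section FlatRKHS

variable {n d : ℕ} {α : ℝ}

/-- The flattened space as a reproducing kernel Hilbert space: its elements, viewed as functions on
`ℝ²ⁿ`, have continuous point evaluations. -/
@[reducible]
def FlatSpace.rkhs (hn : 1 ≤ n) (d : ℕ) (hα : 0 < α) :
    RKHS ℂ (FlatSpace n (d + 1) α hα) (R2 n) ℂ where
  coeCLM :=
    { toFun := toFun
      map_add' := fun _ _ => rfl
      map_smul' := fun _ _ => rfl
      cont := continuous_pi fun p => by
        simp only [← inner_kernelAt hn]
        fun_prop }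
  coeCLM_injective := fun _ _ h => Subtype.ext h

lemma FlatSpace.kerFun_apply_one (hn : 1 ≤ n) (hα : 0 < α)
    [CompleteSpace (FlatSpace n (d + 1) α hα)] (p : R2 n) :
    letI := rkhs hn d hα
    RKHS.kerFun (FlatSpace n (d + 1) α hα) p 1 = kernelAt hn d hα p := by
  let _ := rkhs hn d hα
  refine ext_inner_right ℂ fun g => ?_
  rw [RKHS.kerFun_inner, inner_kernelAt]
  change inner ℂ (1 : ℂ) (g.toFun p) = g.toFun p
  simp

lemma flatKernel_add_left (d : ℕ) (a x y u v : EuclideanSpace ℝ (Fin n)) :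
    flatKernel n d (x + a, y) (u + a, v) = flatKernel n d (x, y) (u, v) := by
  simp only [flatKernel, kernelExponent, add_sub_add_right_eq_sub]

end FlatRKHS

section Dimension

/-- Multi-indices `k` with `|k| ≤ d` correspond to multi-indices of length `d` in one more
variable: the additional entry is the slack `d - |k|`. -/
def sumLtEquivSumEq (n d : ℕ) :
    {k : Fin n → ℕ // ∑ r, k r < d + 1} ≃ {k : Fin (n + 1) → ℕ // ∑ r, k r = d} where
  toFun k := ⟨(Fin.cons (d - ∑ r, k.1 r) k.1 : Fin (n + 1) → ℕ), by
    have := k.2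
    rw [Fin.sum_cons]
    omega⟩
  invFun k := ⟨Fin.tail k.1, by
    have := Fin.sum_univ_succ k.1
    have := k.2
    simp only [Fin.tail]
    omega⟩
  left_inv k := Subtype.ext (Fin.tail_cons (α := fun _ => ℕ) (d - ∑ r, k.1 r) k.1)
  right_inv k := Subtype.ext (by
    have hslack : d - ∑ r, Fin.tail k.1 r = k.1 0 := by
      have := Fin.sum_univ_succ k.1
      have := k.2
      simp only [Fin.tail]
      omega
    simp only [hslack, Fin.cons_self_tail])

lemma dim_succ (n d : ℕ) : dim n (d + 1) = (d + n).choose d := by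
  rw [dim, Nat.card_congr
    ((sumLtEquivSumEq n d).trans (Sym.equivNatSumOfFintype (Fin (n + 1)) d).symm),
    Nat.card_eq_fintype_card, Sym.card_sym_eq_choose, Fintype.card_fin,
    show n + 1 + d - 1 = d + n by omega]

end Dimension

end PolyFock

end

theorem mainTheorem5 (n m : ℕ) (hn : 1 ≤ n) (hm : 1 ≤ m) (α : ℝ) (hα : 0 < α) :
    ∃ (_ : CompleteSpace (PolyFock.FlatSpace n m α hα))
      (_ : RKHS ℂ (PolyFock.FlatSpace n m α hα) (PolyFock.R2 n) ℂ),
      -- the functions of the RKHS are the elements of the flattened space themselves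
      (∀ g : PolyFock.FlatSpace n m α hα, RKHS.coeCLM ℂ g = g.toFun) ∧
      (∀ x y u v : EuclideanSpace ℝ (Fin n),
        (RKHS.kerFun (PolyFock.FlatSpace n m α hα) (x, y) 1).toFun (u, v) =
          2 ^ n *
            Complex.exp (-(1 / 2) * ((‖u - x‖ ^ 2 + ‖v - y‖ ^ 2 : ℝ) : ℂ)
              - Complex.I * (inner ℝ (u - x) (v + y) : ℝ)) *
            (PolyFock.laguerre n (m - 1) (‖u - x‖ ^ 2 + ‖v - y‖ ^ 2) : ℂ)) ∧
      (∀ x y : EuclideanSpace ℝ (Fin n),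
        ‖RKHS.kerFun (PolyFock.FlatSpace n m α hα) (x, y) 1‖ =
          Real.sqrt (2 ^ n * (PolyFock.dim n m : ℝ))) ∧
      PolyFock.dim n m = (n + m - 1).choose n ∧
      (∀ a x y u v : EuclideanSpace ℝ (Fin n),
        (RKHS.kerFun (PolyFock.FlatSpace n m α hα) (x + a, y) 1).toFun (u + a, v) =
          (RKHS.kerFun (PolyFock.FlatSpace n m α hα) (x, y) 1).toFun (u, v)) := by
  obtain ⟨d, rfl⟩ : ∃ d, m = d + 1 := ⟨m - 1, by omega⟩
  have hcomplete := PolyFock.FlatSpace.completeSpace hn d hα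
  let _ := PolyFock.FlatSpace.rkhs hn d hα
  have hker := PolyFock.FlatSpace.kerFun_apply_one (d := d) hn hα
  refine ⟨hcomplete, inferInstance, fun g => rfl, fun x y u v => ?_, fun x y => ?_, ?_,
    fun a x y u v => ?_⟩
  · rw [hker]
    rfl
  · rw [hker, PolyFock.FlatSpace.norm_kernelAt, PolyFock.dim_succ]
  · rw [PolyFock.dim_succ, Nat.choose_symm_add, add_comm d n, ← add_assoc, Nat.add_sub_cancel]
  · rw [hker, hker]
    exact PolyFock.flatKernel_add_left d a x y u v
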